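/- Let $\mathfrak H=\{\tau\in\mathbb C:\operatorname{Im}\tau>0\}$, let $E_4,E_6$ be the normalized Eisenstein series of weights $4,6$ for $SL_2(\mathbb Z)$, $\eta$ the Dedekind eta-function, $\Delta=\eta^{24}$, $J=E_4^3/(1728\,\Delta)$, and $\rho=e^{2\pi i/3}$. Let $n\ge 0$ be an integer and let $(x_1,\dots,x_n)\in(0,1)^n$ be a solution, with pairwise distinct $x_i$, of the system $E^n_{8,9,12}$: $$\frac{8}{x_i}+\frac{9}{x_i-1}+\sum_{j\ne i}\frac{12}{x_i-x_j}=0,\qquad 1\le i\le n.$$ Let $w_i\in\mathfrak H$ with $J(w_i)=x_i$, and put $$f_n=\frac{\eta^{44}}{E_4^2E_6^2\prod_{i=1}^n(J-x_i)^2}=\frac{1}{1728}\cdot\frac{\eta^{20}}{E_4^2\,(J-1)\prod_{i=1}^n(J-x_i)^2}.$$ Then: 1. $f_n$ is a meromorphic modular form of weight $2$ for $SL_2(\mathbb Z)$ with a character: it is meromorphic on $\mathfrak H$ and at the cusp (a meromorphic function near $0$ of $e^{2\pi i\tau/N}$ for some $N\ge1$), and $f_n(\gamma\tau)=\chi(\gamma)(c\tau+d)^2f_n(\tau)$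 for all $\gamma=\begin{pmatrix}a&b\\c&d\end{pmatrix}\in SL_2(\mathbb Z)$, for some homomorphism $\chi:SL_2(\mathbb Z)\to\mathbb C^\times$. 2. $f_n$ has a double pole with zero residue at $i$, at $\rho$, at each $w_i$, and at every point of the $SL_2(\mathbb Z)$-orbits of these points; at all other points of $\mathfrak H$ it is holomorphic and nonvanishing. 3. $f_n$ has an integral on $\mathfrak H$, i.e. there is a (single-valued) meromorphic function $h_n$ on $\mathfrak H$ with $h_n'=f_n$ away from the poles of $f_n$; and every such $h_n$ satisfies $$\{h_n,\tau\}=2\pi^2\left(\frac{12n+11}{6}\right)^2E_4(\tau),\qquad\text{where } \{h,\tau\}=\left(\frac{h''}{h'}\right)'-\frac12\left(\frac{h''}{h'}\right)^2 .$$ The identity holds at every point of $\mathfrak H$ that is not a pole of $f_n$, and $\{h_n,\tau\}$ extends holomorphically across the poles with the same identity. -/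

import Mathlib

open Filter Topology MatrixGroups UpperHalfPlane

noncomputable section

namespace ModularODE

/-- The modular invariant `J = E₄³ / (1728 Δ)`, with `Δ = η²⁴` (so that `J(i) = 1`, `J(ρ) = 0`). -/
def kleinJ (τ : ℍ) : ℂ :=
  ModularForm.E₄ τ ^ 3 / (1728 * ModularForm.discriminant τ)

/-- `x` is a solution of the algebraic system
`a / xᵢ + b / (xᵢ - 1) + ∑_{j ≠ i} c / (xᵢ - xⱼ) = 0`, `1 ≤ i ≤ n`.
Being a solution includes that no denominator vanishes. -/
structure IsSolution {n : ℕ} (a b c : ℝ) (x : Fin n → ℝ) : Prop where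
  injective : Function.Injective x
  ne_zero : ∀ i, x i ≠ 0
  ne_one : ∀ i, x i ≠ 1
  eq_zero : ∀ i, a / x i + b / (x i - 1) + ∑ j ∈ Finset.univ.erase i, c / (x i - x j) = 0

/-- The function `η⁴⁴ / (E₄² E₆² ∏ᵢ (J - xᵢ)²)` on the upper half-plane
(with value `0` at the zeros of the denominator). -/
def fForm {n : ℕ} (x : Fin n → ℝ) (τ : ℍ) : ℂ :=
  ModularForm.eta τ ^ 44 /
    (ModularForm.E₄ τ ^ 2 * ModularForm.E₆ τ ^ 2 * ∏ i, (kleinJ τ - (x i : ℂ)) ^ 2)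

/-- `f` is a meromorphic modular form of weight `k` for `SL(2, ℤ)` with character `χ`:
it is meromorphic on the upper half-plane, satisfies
`f((aτ + b) / (cτ + d)) = χ(γ) (cτ + d)ᵏ f(τ)`, and is meromorphic at the cusp, that is, for
large `Im τ` it is a meromorphic function, near `0`, of `q_N = exp(2πiτ / N)` for some `N ≥ 1`.
(The set of poles being invariant, the transformation law is also meaningful there when all
poles carry the same conventional value `0`.) -/
structure IsMeromorphicModularForm (k : ℤ) (χ : SL(2, ℤ) →* ℂˣ) (f : ℍ → ℂ) : Prop where
  meromorphic : ∀ τ : ℍ, MeromorphicAt (f ∘ ofComplex) (τ : ℂ)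
  transform : ∀ (γ : SL(2, ℤ)) (τ : ℍ),
    f (γ • τ) = (χ γ : ℂ) * (((γ 1 0 : ℤ) : ℂ) * (τ : ℂ) + ((γ 1 1 : ℤ) : ℂ)) ^ k * f τ
  meromorphic_at_cusp : ∃ N : ℕ, 0 < N ∧ ∃ F : ℂ → ℂ, MeromorphicAt F 0 ∧
    ∀ᶠ τ : ℍ in atImInfty, f τ = F (Complex.exp (2 * Real.pi * Complex.I * (τ : ℂ) / N))

/-- `F` (with at most an isolated singularity at `a`) has residue `c` at `a`:
`(1 / 2πi) ∮_{|z - a| = r} F(z) dz = c` for all sufficiently small `r > 0`. -/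
def HasResidueAt (F : ℂ → ℂ) (a c : ℂ) : Prop :=
  ∀ᶠ r : ℝ in 𝓝[>] 0, CircleIntegrable F a r ∧
    (2 * Real.pi * Complex.I)⁻¹ * (∮ z in C(a, r), F z) = c

/-- `F` has a double pole with zero residue at `a`. -/
def HasDoublePoleZeroResidueAt (F : ℂ → ℂ) (a : ℂ) : Prop :=
  MeromorphicAt F a ∧ meromorphicOrderAt F a = ((-2 : ℤ) : WithTop ℤ) ∧ HasResidueAt F a 0

/-- The `SL(2, ℤ)`-orbits of `i`, of `ρ = exp(2πi / 3)` and of the points `wᵢ`. -/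
def poleSet {n : ℕ} (w : Fin n → ℍ) : Set ℍ :=
  MulAction.orbit SL(2, ℤ) UpperHalfPlane.I ∪ MulAction.orbit SL(2, ℤ) UpperHalfPlane.ρ ∪
    ⋃ i, MulAction.orbit SL(2, ℤ) (w i)

/-- `h` is an integral (primitive) of `F` on the upper half-plane: it is a (single-valued)
meromorphic function there, and `h' = F` wherever `F` is holomorphic. -/
def IsIntegralOf (h F : ℂ → ℂ) : Prop :=
  MeromorphicOn h upperHalfPlaneSet ∧
    ∀ z ∈ upperHalfPlaneSet, AnalyticAt ℂ F z → HasDerivAt h (F z) z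

/-- The Schwarz derivative `{h, τ} = (h'' / h')' - (1 / 2) (h'' / h')²`. -/
def schwarzian (h : ℂ → ℂ) (z : ℂ) : ℂ :=
  deriv (fun u => deriv (deriv h) u / deriv h u) z
    - 1 / 2 * (deriv (deriv h) z / deriv h z) ^ 2

end ModularODE

end

/-! The form is an inverse square, `f = u⁻²`, with `u = E₄ E₆ P(J) / η²²` (`seed`) of weight `-1`
and `P = ∏ (X - xᵢ)`. Write `D = (2πi)⁻¹ d/dτ` and `c = n + 11/12`. The algebraic system is the
Heine–Stieltjes condition making `P` solve a hypergeometric equation (`rootPoly_ode`), and by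
Ramanujan's identities this is equivalent to what is needed here: `D²u = c² E₄ u`
(`hasDerivAt_seed`, `hasDerivAt_seedDeriv`).

Everything else comes from this linear equation. Its nontrivial solutions have simple zeros, so
`u⁻²` has exactly double poles. A second solution `v`, with exponent `c` at the cusp, comes from the
Frobenius method (`exists_frobenius_solution`). The Wronskian `W = u v' - u' v` is constant, and
nonzero because `u` and `v` have different multipliers under `τ ↦ τ + 1`. Hence `(v / u)' = W u⁻²`:
the form has the single-valued primitive `v / (W u)`, which forces all residues to vanish. Any
primitive `h` has `h' = u⁻²`, and then `{h, τ} = -2 u'' / u = 8π² c² E₄`.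

The zeros of `u` are the points where `J` is `0`, `1` or some `xᵢ`. Identifying them with orbits
requires that `J` separate orbits (`exists_smul_eq_of_kleinJ_eq`). This follows from the fact that a
lattice is determined by `g₂` and `g₃`, through uniqueness of the Weierstrass function. -/

namespace ModularODE

open ModularForm EisensteinSeries Derivative Function
open scoped Manifold

/-! ### Ramanujan's identities for `E₂`, `E₄`, `E₆`. -/

/-- `F` is a holomorphic function of `q = exp(2πiτ)` on the open unit disc. -/
def IsHolomorphicInQ (F : ℍ → ℂ) : Prop :=
  ∃ G : ℂ → ℂ, DifferentiableOn ℂ G (Metric.ball 0 1) ∧ ∀ τ : ℍ, F τ = G (Periodic.qParam 1 τ)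

lemma qParam_mem_ball (τ : ℍ) : Periodic.qParam 1 τ ∈ Metric.ball (0 : ℂ) 1 := by
  simpa using norm_qParam_lt_one 1 τ

lemma hasDerivAt_qParam_one (z : ℂ) :
    HasDerivAt (Periodic.qParam 1) (2 * Real.pi * Complex.I * Periodic.qParam 1 z) z := by
  have h : HasDerivAt (fun w : ℂ ↦ Complex.exp (2 * Real.pi * Complex.I * w))
      (Complex.exp (2 * Real.pi * Complex.I * z) * (2 * Real.pi * Complex.I * 1)) z :=
    ((hasDerivAt_id z).const_mul _).cexp
  have e : Periodic.qParam 1 = fun w : ℂ ↦ Complex.exp (2 * Real.pi * Complex.I * w) := by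
    ext w; simp [Periodic.qParam]
  rw [e]
  exact h.congr_deriv (by ring)

lemma normalizedDeriv_of_eq_qParam {F : ℍ → ℂ} {G : ℂ → ℂ}
    (hG : DifferentiableOn ℂ G (Metric.ball 0 1)) (h : ∀ τ : ℍ, F τ = G (Periodic.qParam 1 τ))
    (τ : ℍ) : normalizedDerivOfComplex F τ =
      Periodic.qParam 1 τ * deriv G (Periodic.qParam 1 τ) := by
  have e : F ∘ ofComplex =ᶠ[𝓝 (τ : ℂ)] G ∘ Periodic.qParam 1 := by
    filter_upwards [isOpen_upperHalfPlaneSet.mem_nhds τ.im_pos] with w hw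
    simp [Function.comp, h, ofComplex_apply_of_im_pos hw]
  have hG' := (hG.differentiableAt
    (Metric.isOpen_ball.mem_nhds (qParam_mem_ball τ))).hasDerivAt.comp (τ : ℂ)
      (hasDerivAt_qParam_one τ)
  rw [normalizedDerivOfComplex, e.deriv_eq, hG'.deriv]
  field_simp [Complex.two_pi_I_ne_zero]

lemma IsHolomorphicInQ.tendsto {F : ℍ → ℂ} {G : ℂ → ℂ}
    (hG : DifferentiableOn ℂ G (Metric.ball 0 1)) (h : ∀ τ : ℍ, F τ = G (Periodic.qParam 1 τ)) :
    Tendsto F atImInfty (𝓝 (G 0)) := by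
  have hc : ContinuousAt G 0 :=
    (hG.differentiableAt (Metric.ball_mem_nhds 0 one_pos)).continuousAt
  exact (hc.tendsto.comp (qParam_tendsto_atImInfty one_pos)).congr fun τ ↦ (h τ).symm

/-- `D` acts as `q d/dq`, which kills the value at `q = 0`. Only the `E₂` term of a Serre derivative
therefore survives at the cusp. -/
lemma IsHolomorphicInQ.tendsto_normalizedDeriv {F : ℍ → ℂ} (h : IsHolomorphicInQ F) :
    Tendsto (normalizedDerivOfComplex F) atImInfty (𝓝 0) := by
  obtain ⟨G, hG, h⟩ := h
  have := IsHolomorphicInQ.tendsto (F := normalizedDerivOfComplex F)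
    (G := fun q ↦ q * deriv G q) (differentiableOn_id.mul (hG.deriv Metric.isOpen_ball))
    (normalizedDeriv_of_eq_qParam hG h)
  simpa using this

lemma modularForm_eq_qParam {k : ℤ} (f : ModularForm 𝒮ℒ k) :
    DifferentiableOn ℂ (cuspFunction 1 f) (Metric.ball 0 1) ∧
      ∀ τ : ℍ, f τ = cuspFunction 1 f (Periodic.qParam 1 τ) :=
  ⟨fun q hq ↦ (ModularFormClass.differentiableAt_cuspFunction f one_pos one_mem_strictPeriods_SL
    (by simpa using hq)).differentiableWithinAt,
   fun τ ↦ by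
    simpa using (SlashInvariantFormClass.eq_cuspFunction (h := 1) f τ
      one_mem_strictPeriods_SL one_ne_zero).symm⟩

lemma isHolomorphicInQ_modularForm {k : ℤ} (f : ModularForm 𝒮ℒ k) : IsHolomorphicInQ f :=
  ⟨_, modularForm_eq_qParam f⟩

lemma cuspFunction_E_zero {k : ℕ} (hk : 3 ≤ k) (hk2 : Even k) :
    cuspFunction 1 (E hk) 0 = 1 := by
  have := E_qExpansion_coeff_zero hk hk2
  rw [qExpansion_coeff] at this
  simpa using this

lemma tendsto_E {k : ℕ} (hk : 3 ≤ k) (hk2 : Even k) : Tendsto (E hk) atImInfty (𝓝 1) := by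
  have h := modularForm_eq_qParam (E hk)
  have := IsHolomorphicInQ.tendsto h.1 h.2
  rwa [cuspFunction_E_zero hk hk2] at this

lemma tprod_one_sub_pow_ne_zero {q : ℂ} (hq : q ∈ Metric.ball (0 : ℂ) 1) :
    ∏' n : ℕ, (1 - q ^ (n + 1)) ≠ 0 := by
  have hq' : ‖q‖ < 1 := by simpa using hq
  refine tprod_one_add_ne_zero_of_summable (f := fun n ↦ -q ^ (n + 1)) (fun i h ↦ ?_) ?_
  · have h1 : q ^ (i + 1) = 1 := by linear_combination -h
    have h2 := pow_lt_one₀ (norm_nonneg q) hq' (Nat.succ_ne_zero i)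
    rw [← norm_pow, h1, norm_one] at h2
    exact lt_irrefl _ h2
  · simpa using (summable_nat_add_iff 1).mpr (summable_geometric_of_lt_one (norm_nonneg _) hq')

/-- `E₂` as a function of `q`, through the logarithmic derivative of `η`. -/
lemma E2_eq_qParam (τ : ℍ) : E2 τ = (fun q : ℂ ↦ 1 + 24 * (q *
      deriv (fun q : ℂ ↦ ∏' n : ℕ, (1 - q ^ (n + 1))) q / ∏' n : ℕ, (1 - q ^ (n + 1))))
      (Periodic.qParam 1 τ) := by
  set U : ℂ → ℂ := fun q ↦ ∏' n : ℕ, (1 - q ^ (n + 1)) with hU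
  have h := logDeriv_eta_eq_E2 τ
  have hd : HasDerivAt (U ∘ Periodic.qParam 1) _ (τ : ℂ) :=
    (differentiableOn_tprod_one_sub_pow.differentiableAt
      (Metric.isOpen_ball.mem_nhds (qParam_mem_ball τ))).hasDerivAt.comp (τ : ℂ)
        (hasDerivAt_qParam_one τ)
  have e : eta = fun z ↦ Periodic.qParam 24 z * (U ∘ Periodic.qParam 1) z := by
    ext z; rfl
  have hU0 : U (Periodic.qParam 1 τ) ≠ 0 := tprod_one_sub_pow_ne_zero (qParam_mem_ball τ)
  rw [e, logDeriv_mul (f := Periodic.qParam 24) (g := U ∘ Periodic.qParam 1) _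
    (Periodic.qParam_ne_zero _) hU0 (by fun_prop) hd.differentiableAt,
    logDeriv_qParam, logDeriv_apply, hd.deriv] at h
  simp only [Function.comp] at h
  change _ = 1 + 24 * (Periodic.qParam 1 τ * deriv U (Periodic.qParam 1 τ) /
    U (Periodic.qParam 1 τ))
  have hpi := Complex.two_pi_I_ne_zero
  have h2 : (Real.pi * Complex.I : ℂ) ≠ 0 := by
    intro h0; apply hpi; linear_combination 2 * h0
  apply mul_left_cancel₀ h2
  push_cast at h
  linear_combination -12 * h

lemma differentiableOn_E2_q : DifferentiableOn ℂ (fun q : ℂ ↦ 1 + 24 * (q *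
      deriv (fun q : ℂ ↦ ∏' n : ℕ, (1 - q ^ (n + 1))) q / ∏' n : ℕ, (1 - q ^ (n + 1))))
      (Metric.ball 0 1) :=
  (differentiableOn_const _).add ((differentiableOn_const _).mul
    ((differentiableOn_id.mul (differentiableOn_tprod_one_sub_pow.deriv Metric.isOpen_ball)).div
      differentiableOn_tprod_one_sub_pow fun _ hq ↦ tprod_one_sub_pow_ne_zero hq))

lemma isHolomorphicInQ_E2 : IsHolomorphicInQ E2 := ⟨_, differentiableOn_E2_q, E2_eq_qParam⟩

lemma tendsto_E2 : Tendsto E2 atImInfty (𝓝 1) := by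
  simpa using IsHolomorphicInQ.tendsto differentiableOn_E2_q E2_eq_qParam

/-- A holomorphic slash-invariant function with a limit at the cusp is a modular form. -/
lemma exists_modularForm {k : ℤ} {F : ℍ → ℂ} (hF : MDiff F) (hs : ∀ γ : SL(2, ℤ), F ∣[k] γ = F)
    {c : ℂ} (hc : Tendsto F atImInfty (𝓝 c)) : ∃ f : ModularForm 𝒮ℒ k, ⇑f = F := by
  refine ⟨{ toFun := F
            slash_action_eq' := ?_
            holo' := hF
            bdd_at_cusps' := ?_ }, rfl⟩
  · rintro A ⟨A, rfl⟩
    exact hs A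
  · intro c' hc'
    rw [Subgroup.IsArithmetic.isCusp_iff_isCusp_SL2Z] at hc'
    rw [OnePoint.isBoundedAt_iff_forall_SL2Z hc']
    intro γ _
    rw [hs]
    exact hc.isBigO_one ℝ

/-- Below weight 12 there are no cusp forms, so the space is spanned by the Eisenstein series and
the factor is read off at the cusp. Each Ramanujan identity reduces to such a comparison of limits.
-/
lemma eq_smul_E {k : ℕ} (hk : 3 ≤ k) (hk2 : Even k) (hk12 : k < 12) {F : ℍ → ℂ} (hF : MDiff F)
    (hs : ∀ γ : SL(2, ℤ), F ∣[(k : ℤ)] γ = F) {c : ℂ} (hc : Tendsto F atImInfty (𝓝 c)) (τ : ℍ) :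
    F τ = c * E hk τ := by
  obtain ⟨f, rfl⟩ := exists_modularForm hF hs hc
  have hr : Module.rank ℂ (ModularForm 𝒮ℒ k) = 1 := by
    rw [ModularForm.rank_eq_one_add_rank_cuspForm hk hk2,
      CuspForm.rank_eq_zero_of_weight_lt_twelve (by exact_mod_cast hk12), add_zero]
  obtain ⟨a, rfl⟩ := (finrank_eq_one_iff_of_nonzero' _ (E_ne_zero hk hk2)).mp
    (Module.rank_eq_one_iff_finrank_eq_one.mp hr) f
  have h1 : Tendsto (fun τ ↦ a * E hk τ) atImInfty (𝓝 (a * 1)) := (tendsto_E hk hk2).const_mul a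
  have := tendsto_nhds_unique hc h1
  rw [this, mul_one]
  rfl

lemma modularForm_slash {k : ℤ} (f : ModularForm 𝒮ℒ k) (γ : SL(2, ℤ)) : ⇑f ∣[k] γ = f :=
  SlashInvariantFormClass.slash_action_eq f _ ⟨γ, rfl⟩

lemma tendsto_serreDerivative {F : ℍ → ℂ} (k : ℂ) (hF : IsHolomorphicInQ F) {a : ℂ}
    (ha : Tendsto F atImInfty (𝓝 a)) :
    Tendsto (serreDerivative k F) atImInfty (𝓝 (-k / 12 * a)) := by
  have := hF.tendsto_normalizedDeriv.sub ((tendsto_E2.const_mul (k * 12⁻¹)).mul ha)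
  rwa [show 0 - k * 12⁻¹ * 1 * a = -k / 12 * a by ring] at this

/-- Ramanujan's identity `D E₄ = (E₂ E₄ - E₆) / 3`. -/
lemma normalizedDeriv_E₄ (τ : ℍ) :
    normalizedDerivOfComplex E₄ τ = (E2 τ * E₄ τ - E₆ τ) / 3 := by
  have h := eq_smul_E (k := 6) (by norm_num) (by decide) (by norm_num)
    (serreDerivative_mdifferentiable 4 E₄.holo')
    (fun γ ↦ by
      have := serreDerivative_slash_invariant (k := 4) E₄.holo' (modularForm_slash E₄ γ)
      exact_mod_cast this)
    (tendsto_serreDerivative 4 (isHolomorphicInQ_modularForm E₄)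
      (tendsto_E _ (by decide))) τ
  rw [serreDerivative_apply] at h
  linear_combination h

/-- Ramanujan's identity `D E₆ = (E₂ E₆ - E₄²) / 2`. -/
lemma normalizedDeriv_E₆ (τ : ℍ) :
    normalizedDerivOfComplex E₆ τ = (E2 τ * E₆ τ - E₄ τ ^ 2) / 2 := by
  have h := eq_smul_E (k := 8) (by norm_num) (by decide) (by norm_num)
    (serreDerivative_mdifferentiable 6 E₆.holo')
    (fun γ ↦ by
      have := serreDerivative_slash_invariant (k := 6) E₆.holo' (modularForm_slash E₆ γ)
      exact_mod_cast this)
    (tendsto_serreDerivative 6 (isHolomorphicInQ_modularForm E₆)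
      (tendsto_E _ (by decide))) τ
  have h4 := tendsto_E (k := 4) (by norm_num) (by decide)
  -- The Serre derivative of `E₆` is a multiple of `E₈`, and the same one-dimensionality gives `E₈ =
  -- E₄²`.
  have h2 := eq_smul_E (k := 8) (by norm_num) (by decide) (by norm_num)
    (F := E₄ * E₄) (E₄.holo'.mul E₄.holo')
    (fun γ ↦ by
      have := ModularForm.mul_slash_SL2 4 4 γ E₄ E₄
      rw [modularForm_slash] at this
      exact_mod_cast this)
    (by simpa using! h4.mul h4) τ
  rw [serreDerivative_apply] at h
  rw [Pi.mul_apply] at h2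
  linear_combination h + 1 / 2 * h2

lemma hasDerivAt_D2 (γ : SL(2, ℤ)) (τ : ℍ) :
    HasDerivAt (D2 γ ∘ ofComplex)
      (-(2 * Real.pi * Complex.I * (γ 1 0 : ℂ) ^ 2 / denom γ τ ^ 2)) (τ : ℂ) := by
  have h := (hasDerivAt_denom_zpow (γ : GL (Fin 2) ℝ) (-1) τ).const_mul
    (2 * Real.pi * Complex.I * (γ 1 0 : ℂ))
  have e : D2 γ ∘ ofComplex =ᶠ[𝓝 (τ : ℂ)]
      fun z ↦ 2 * Real.pi * Complex.I * (γ 1 0 : ℂ) * denom (γ : GL (Fin 2) ℝ) z ^ (-1 : ℤ) := by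
    filter_upwards [isOpen_upperHalfPlaneSet.mem_nhds τ.im_pos] with w hw
    simp [D2, ofComplex_apply_of_im_pos hw, div_eq_mul_inv]
  refine (h.congr_of_eventuallyEq e).congr_deriv ?_
  have hz := denom_ne_zero (γ : GL (Fin 2) ℝ) τ
  have : (((γ : GL (Fin 2) ℝ) 1 0 : ℝ) : ℂ) = (γ 1 0 : ℂ) := by simp
  rw [this]
  norm_num
  ring

/-- `E₂` fails to be modular by an additive term in `C / (Cτ + d)`. The defects this causes in `D
E₂` and in `E₂² / 12` are equal, so the difference is modular of weight 4. -/
lemma normalizedDeriv_E2_sub_slash (γ : SL(2, ℤ)) :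
    (fun τ ↦ normalizedDerivOfComplex E2 τ - E2 τ ^ 2 / 12) ∣[(4 : ℤ)] γ =
      fun τ ↦ normalizedDerivOfComplex E2 τ - E2 τ ^ 2 / 12 := by
  ext τ
  have h1 := congrFun (normalizedDerivOfComplex_SL_slash (k := 2) E2_mdifferentiable (γ := γ)) τ
  have hE := congrFun (E2_slash_action γ) τ
  rw [E2_slash_action γ] at h1
  have hE2 : DifferentiableAt ℂ (E2 ∘ ofComplex) (τ : ℂ) :=
    UpperHalfPlane.mdifferentiableAt_iff.mp (E2_mdifferentiable τ)
  have h2 : normalizedDerivOfComplex (E2 - (1 / (2 * riemannZeta 2)) • D2 γ) τ =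
      normalizedDerivOfComplex E2 τ + (1 / (2 * riemannZeta 2)) *
        ((γ 1 0 : ℂ) ^ 2 / denom γ τ ^ 2) := by
    have e := (hE2.hasDerivAt.sub ((hasDerivAt_D2 γ τ).const_mul (1 / (2 * riemannZeta 2)))).deriv
    simp only [normalizedDerivOfComplex]
    rw [show (E2 - (1 / (2 * riemannZeta 2)) • D2 γ) ∘ ofComplex =
      (E2 ∘ ofComplex) - fun z ↦ (1 / (2 * riemannZeta 2)) * (D2 γ ∘ ofComplex) z from rfl, e]
    field_simp [Complex.two_pi_I_ne_zero]
    ring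
  rw [h2] at h1
  have hz := denom_ne_zero (γ : GL (Fin 2) ℝ) τ
  have hpi : (Real.pi : ℂ) ≠ 0 := by exact_mod_cast Real.pi_ne_zero
  have hI := Complex.I_ne_zero
  have hI2 := Complex.I_sq
  simp only [Pi.sub_apply, Pi.smul_apply, smul_eq_mul, D2, riemannZeta_two] at h1 hE
  rw [SL_slash_apply] at hE
  rw [SL_slash_apply]
  simp only [SL_slash_apply] at h1
  generalize normalizedDerivOfComplex E2 (γ • τ) = A at *
  generalize normalizedDerivOfComplex E2 τ = B at *
  generalize E2 (γ • τ) = a at *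
  generalize E2 τ = b at *
  generalize denom (γ : GL (Fin 2) ℝ) (τ : ℂ) = d at *
  generalize (γ 1 0 : ℂ) = C at *
  have hz2 : d ^ (-(2 : ℤ)) = (d ^ 2)⁻¹ := by rw [zpow_neg]; rfl
  have hz4 : d ^ (-(4 : ℤ)) = (d ^ 4)⁻¹ := by rw [zpow_neg]; rfl
  have hz22 : d ^ (-((2 : ℤ) + 2)) = (d ^ 4)⁻¹ := by rw [zpow_neg]; rfl
  rw [hz2] at hE
  rw [hz22] at h1
  rw [hz4]
  -- `hX` and `hY` isolate the two defects. Squaring `hY` and dividing by 12 reproduces both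
  -- correction terms of `hX`, using `I² = -1`.
  have hX : A * (d ^ 4)⁻¹ = B - 3 * (Real.pi : ℂ)⁻¹ ^ 2 * (C / d) ^ 2 -
      Complex.I * (Real.pi : ℂ)⁻¹ * (C / d) * b := by
    push_cast at h1
    field_simp at h1 ⊢
    linear_combination (Complex.I / 2) * h1 - ((Real.pi : ℂ) ^ 2 * B * d ^ 4 + 3 * C ^ 2 * d ^ 2 -
      (Real.pi : ℂ) ^ 2 * A - 6 * C ^ 2 * d ^ 2) * hI2
  have hY : a * (d ^ 2)⁻¹ = b - 6 * Complex.I * (Real.pi : ℂ)⁻¹ * (C / d) := by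
    rw [hE]; field_simp
  have : (A - a ^ 2 / 12) * (d ^ 4)⁻¹ = A * (d ^ 4)⁻¹ - (a * (d ^ 2)⁻¹) ^ 2 / 12 := by
    field_simp
  rw [this, hX, hY]
  linear_combination 3 * ((Real.pi : ℂ)⁻¹ ^ 2 * (C / d) ^ 2) * (-hI2)

/-- Ramanujan's identity `D E₂ = (E₂² - E₄) / 12`. -/
lemma normalizedDeriv_E2 (τ : ℍ) :
    normalizedDerivOfComplex E2 τ = (E2 τ ^ 2 - E₄ τ) / 12 := by
  have hd : MDiff (fun τ : ℍ ↦ (normalizedDerivOfComplex E2 τ - E2 τ ^ 2 / 12 : ℂ)) := by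
    have h : MDiff (fun τ : ℍ ↦ (normalizedDerivOfComplex E2 τ - 1 / 12 * (E2 τ * E2 τ) : ℂ)) :=
      (normalizedDerivOfComplex_mdifferentiable E2_mdifferentiable).sub
      (mdifferentiable_const.mul (E2_mdifferentiable.mul E2_mdifferentiable))
    convert! h using 2
    ring
  have h := eq_smul_E (k := 4) (by norm_num) (by decide) (by norm_num) hd
    normalizedDeriv_E2_sub_slash
    (isHolomorphicInQ_E2.tendsto_normalizedDeriv.sub ((tendsto_E2.pow 2).div_const 12)) τ
  linear_combination h

end ModularODE

/-! ### The Heine–Stieltjes equation for the polynomial with roots `xᵢ`. -/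

namespace ModularODE

section Polynomial

open Polynomial

/-- The monic polynomial with roots `xᵢ`. -/
noncomputable def rootPoly {n : ℕ} (x : Fin n → ℝ) : ℂ[X] := ∏ i, (X - C (x i : ℂ))

lemma rootPoly_eval {n : ℕ} (x : Fin n → ℝ) (t : ℂ) :
    (rootPoly x).eval t = ∏ i, (t - (x i : ℂ)) := by
  simp [rootPoly, eval_prod]

lemma rootPoly_natDegree {n : ℕ} (x : Fin n → ℝ) : (rootPoly x).natDegree = n := by
  simp [rootPoly, natDegree_finsetProd_X_sub_C_eq_card]

lemma eval_derivative_prod_X_sub_C {ι : Type*} [DecidableEq ι] (s : Finset ι) (x : ι → ℂ) (t : ℂ)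
    (h : ∀ i ∈ s, t - x i ≠ 0) : (derivative (∏ i ∈ s, (X - C (x i)))).eval t =
      (∏ i ∈ s, (t - x i)) * ∑ i ∈ s, 1 / (t - x i) := by
  rw [derivative_prod_finset, eval_finsetSum, Finset.mul_sum]
  refine Finset.sum_congr rfl fun i hi ↦ ?_
  rw [← Finset.mul_prod_erase s _ hi]
  have := h i hi
  simp [eval_prod]
  field_simp

/-- Writing `P = (X - xᵢ) Q` gives `P'(xᵢ) = Q(xᵢ)` and `P''(xᵢ) = 2 Q'(xᵢ)`. The logarithmic
derivative of `Q` at `xᵢ` is the sum occurring in the system. -/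
lemma eval_derivative_rootPoly {n : ℕ} {x : Fin n → ℝ} (hx : Function.Injective x) (i : Fin n) :
    (derivative (derivative (rootPoly x))).eval (x i : ℂ) =
      2 * (∑ j ∈ Finset.univ.erase i, 1 / ((x i : ℂ) - x j)) *
        (derivative (rootPoly x)).eval (x i : ℂ) := by
  have hne : ∀ j ∈ Finset.univ.erase i, (x i : ℂ) - x j ≠ 0 := fun j hj h ↦
    (Finset.ne_of_mem_erase hj) (hx (by exact_mod_cast (sub_eq_zero.mp h).symm))
  have hP : rootPoly x = (X - C (x i : ℂ)) * ∏ j ∈ Finset.univ.erase i, (X - C (x j : ℂ)) :=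
    (Finset.mul_prod_erase _ _ (Finset.mem_univ i)).symm
  have hd := eval_derivative_prod_X_sub_C (Finset.univ.erase i) (fun j ↦ (x j : ℂ)) (x i : ℂ) hne
  set Q := ∏ j ∈ Finset.univ.erase i, (X - C (x j : ℂ)) with hQ
  have hQe : Q.eval (x i : ℂ) = ∏ j ∈ Finset.univ.erase i, ((x i : ℂ) - x j) := by
    simp [hQ, eval_prod]
  rw [hP]
  simp only [derivative_mul, derivative_sub, derivative_X, derivative_C, sub_zero, one_mul,
    derivative_add, eval_add, eval_mul, eval_sub, eval_X, eval_C, sub_self, zero_mul, add_zero,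
    hd, hQe]
  ring

/-- The second order differential equation satisfied by the polynomial whose roots solve the
system `E_{8,9,12}` (the Heine–Stieltjes correspondence). -/
lemma rootPoly_ode {n : ℕ} {x : Fin n → ℝ} (h : IsSolution 8 9 12 x) :
    X * (X - 1) * derivative (derivative (rootPoly x)) +
      (C (17 / 6) * X - C (4 / 3)) * derivative (rootPoly x) =
        C ((n : ℂ) ^ 2 + 11 / 6 * n) * rootPoly x := by
  obtain ⟨l, hl⟩ : ∃ l : ℂ, l = (n : ℂ) ^ 2 + 11 / 6 * n := ⟨_, rfl⟩
  rw [← sub_eq_zero, ← hl]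
  have hinj : Function.Injective fun i ↦ (x i : ℂ) := fun i j hij ↦
    h.injective (Complex.ofReal_injective hij)
  refine eq_zero_of_degree_lt_of_eval_finset_eq_zero (Finset.univ.map ⟨_, hinj⟩) ?_ ?_
  -- The difference of the two sides has degree at most `n`, and the constant `n² + 11n/6 = n(n - 1)
  -- + 17n/6` is the one cancelling its coefficient of `Xⁿ`. Degree below `n` together with `n`
  -- distinct zeros gives zero. The cases `0`, `1`, `m + 2` follow the coefficients of `X p` and `X²
  -- p`.
  · rw [Finset.card_map, Finset.card_univ, Fintype.card_fin, degree_lt_iff_coeff_zero]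
    intro m hm
    have hz : ∀ k, n < k → (rootPoly x).coeff k = 0 := fun k hk ↦
      coeff_eq_zero_of_natDegree_lt (by rwa [rootPoly_natDegree])
    have e : X * (X - 1) * derivative (derivative (rootPoly x)) +
        (C (17 / 6) * X - C (4 / 3)) * derivative (rootPoly x) -
          C l * rootPoly x =
        X * (X * derivative (derivative (rootPoly x))) - X * derivative (derivative (rootPoly x)) +
          C (17 / 6) * (X * derivative (rootPoly x)) - C (4 / 3) * derivative (rootPoly x) -
          C l * rootPoly x := by ring
    rw [e]
    rcases m with _ | _ | m
    · obtain rfl : n = 0 := by omega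
      simp [hz 1, coeff_derivative]
      left
      simp [hl]
    · rcases hm.lt_or_eq with hm' | rfl
      · simp [hz 1 hm', hz 2 (by omega), coeff_derivative]
      · simp [hz 2, coeff_derivative]
        rw [hl]
        push_cast
        ring
    · rcases hm.lt_or_eq with hm' | rfl
      · simp [hz _ hm', hz (m + 1 + 1 + 1) (by omega), coeff_derivative]
      · simp [hz (m + 1 + 1 + 1), coeff_derivative]
        rw [hl]
        push_cast
        ring
  · intro t ht
    obtain ⟨i, -, rfl⟩ := Finset.mem_map.mp ht
    simp only [Function.Embedding.coeFn_mk]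
    have h0 : (x i : ℂ) ≠ 0 := by exact_mod_cast h.ne_zero i
    have h1 : (x i : ℂ) - 1 ≠ 0 := sub_ne_zero.mpr (by exact_mod_cast h.ne_one i)
    have hs : (8 : ℂ) / x i + 9 / (x i - 1) + ∑ j ∈ Finset.univ.erase i, 12 / ((x i : ℂ) - x j) = 0 := by
      exact_mod_cast h.eq_zero i
    have hs' : ∑ j ∈ Finset.univ.erase i, (12 : ℂ) / ((x i : ℂ) - x j) =
        12 * ∑ j ∈ Finset.univ.erase i, 1 / ((x i : ℂ) - x j) := by
      rw [Finset.mul_sum]; exact Finset.sum_congr rfl fun _ _ ↦ by ring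
    have hP : (rootPoly x).eval (x i : ℂ) = 0 := by
      rw [rootPoly_eval]; exact Finset.prod_eq_zero (Finset.mem_univ i) (sub_self _)
    rw [hs'] at hs
    simp only [eval_sub, eval_add, eval_mul, eval_X, eval_C, eval_one, hP, mul_zero, sub_zero,
      eval_derivative_rootPoly h.injective i]
    generalize ∑ j ∈ Finset.univ.erase i, 1 / ((x i : ℂ) - x j) = S at hs ⊢
    field_simp at hs
    -- One sixth of the `i`-th equation, cleared of denominators and multiplied by `P'(xᵢ)`, is the
    -- differential equation at `xᵢ`: `8/6 = 4/3` and `(8 + 9)/6 = 17/6`.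
    linear_combination (1 / 6) * (derivative (rootPoly x)).eval (x i : ℂ) * hs

/-- The polynomial `R` with `ϑ y = 1728 η² R(J)`. -/
noncomputable def auxPoly {n : ℕ} (x : Fin n → ℝ) : ℂ[X] :=
  -(C (5 / 6) * X - C (1 / 3)) * rootPoly x - X * (X - 1) * derivative (rootPoly x)

/-- Up to sign, `R'` is the left side of the equation for `P` plus `(5/6) P`, so that equation makes
`R'` proportional to `P`. In terms of `c = n + 11/12`, the constant is `-(n² + 11n/6 + 5/6) = 1/144
- c²`. -/
lemma derivative_auxPoly {n : ℕ} {x : Fin n → ℝ} (h : IsSolution 8 9 12 x) :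
    derivative (auxPoly x) = C (1 / 144 - ((12 * n + 11) / 12 : ℂ) ^ 2) * rootPoly x := by
  have e := rootPoly_ode h
  have e1 : (C (1 / 144 - ((12 * n + 11) / 12 : ℂ) ^ 2) : ℂ[X]) =
      -C (5 / 6) - C ((n : ℂ) ^ 2 + 11 / 6 * n) := by
    rw [← C_neg, ← C_sub]; congr 1; ring
  have e2 : (C (17 / 6) : ℂ[X]) = C (5 / 6) + 2 := by
    rw [← C_ofNat, ← C_add]; congr 1; norm_num
  have e3 : (C (4 / 3) : ℂ[X]) = C (1 / 3) + 1 := by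
    rw [← C_1, ← C_add]; congr 1; norm_num
  rw [e2, e3] at e
  rw [e1]
  simp only [auxPoly, derivative_sub, derivative_mul, derivative_neg, derivative_X, derivative_C,
    derivative_one]
  linear_combination -e

end Polynomial

end ModularODE

/-! ### The linear differential equation satisfied by `seed`. -/

namespace ModularODE

open ModularForm EisensteinSeries Derivative
open scoped Manifold

lemma hasDerivAt_of_mdiff {F : ℍ → ℂ} (hF : MDiff F) (τ : ℍ) :
    HasDerivAt (F ∘ ofComplex)
      (2 * Real.pi * Complex.I * normalizedDerivOfComplex F τ) (τ : ℂ) := by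
  have h := (UpperHalfPlane.mdifferentiableAt_iff.mp (hF τ)).hasDerivAt
  refine h.congr_deriv ?_
  rw [normalizedDerivOfComplex]
  field_simp [Complex.two_pi_I_ne_zero]

lemma hasDerivAt_E2 (τ : ℍ) : HasDerivAt (E2 ∘ ofComplex)
    (2 * Real.pi * Complex.I * ((E2 τ ^ 2 - E₄ τ) / 12)) (τ : ℂ) :=
  normalizedDeriv_E2 τ ▸ hasDerivAt_of_mdiff E2_mdifferentiable τ

lemma hasDerivAt_E₄ (τ : ℍ) : HasDerivAt (E₄ ∘ ofComplex)
    (2 * Real.pi * Complex.I * ((E2 τ * E₄ τ - E₆ τ) / 3)) (τ : ℂ) :=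
  normalizedDeriv_E₄ τ ▸ hasDerivAt_of_mdiff E₄.holo' τ

lemma hasDerivAt_E₆ (τ : ℍ) : HasDerivAt (E₆ ∘ ofComplex)
    (2 * Real.pi * Complex.I * ((E2 τ * E₆ τ - E₄ τ ^ 2) / 2)) (τ : ℂ) :=
  normalizedDeriv_E₆ τ ▸ hasDerivAt_of_mdiff E₆.holo' τ

/-- `η` as a function on the upper half-plane. -/
noncomputable def etaH (τ : ℍ) : ℂ := eta τ

lemma etaH_ne_zero (τ : ℍ) : etaH τ ≠ 0 := eta_ne_zero τ.2

lemma hasDerivAt_etaH (τ : ℍ) : HasDerivAt (etaH ∘ ofComplex)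
    (2 * Real.pi * Complex.I * (E2 τ * etaH τ / 24)) (τ : ℂ) := by
  have h := (differentiableAt_eta_of_mem_upperHalfPlaneSet τ.2).hasDerivAt
  have h2 := logDeriv_eta_eq_E2 τ
  rw [logDeriv_apply, div_eq_iff (eta_ne_zero τ.2)] at h2
  rw [h2] at h
  have e : etaH ∘ ofComplex =ᶠ[𝓝 (τ : ℂ)] eta := by
    filter_upwards [isOpen_upperHalfPlaneSet.mem_nhds τ.im_pos] with w hw
    simp [etaH, ofComplex_apply_of_im_pos hw]
  refine (h.congr_of_eventuallyEq e).congr_deriv ?_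
  rw [etaH]
  ring

lemma E₄_cube_sub_E₆_sq (τ : ℍ) : E₄ τ ^ 3 - E₆ τ ^ 2 = 1728 * etaH τ ^ 24 := by
  have := discriminant_eq_E₄_cube_sub_E₆_sq τ
  rw [discriminant] at this
  rw [etaH, this]
  ring

lemma E₄_cube_eq (τ : ℍ) : E₄ τ ^ 3 = 1728 * etaH τ ^ 24 * kleinJ τ := by
  have := etaH_ne_zero τ
  rw [kleinJ, discriminant, ← etaH]
  field_simp

lemma E₆_sq_eq (τ : ℍ) : E₆ τ ^ 2 = 1728 * etaH τ ^ 24 * (kleinJ τ - 1) := by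
  linear_combination E₄_cube_eq τ - E₄_cube_sub_E₆_sq τ

lemma hasDerivAt_kleinJ (τ : ℍ) : HasDerivAt (kleinJ ∘ ofComplex)
    (2 * Real.pi * Complex.I * (-(E₄ τ ^ 2 * E₆ τ / (1728 * etaH τ ^ 24)))) (τ : ℂ) := by
  have h0 : etaH τ ≠ 0 := etaH_ne_zero τ
  have h : HasDerivAt (fun z ↦ (E₄ ∘ ofComplex) z ^ 3 / (1728 * (etaH ∘ ofComplex) z ^ 24)) _
      (τ : ℂ) := ((hasDerivAt_E₄ τ).fun_pow 3).fun_div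
        (((hasDerivAt_etaH τ).fun_pow 24).const_mul 1728) (by simp [h0])
  refine h.congr_deriv ?_
  simp only [Function.comp, ofComplex_apply]
  field_simp
  ring

lemma hasDerivAt_eval_kleinJ (p : Polynomial ℂ) (τ : ℍ) :
    HasDerivAt (fun z ↦ p.eval ((kleinJ ∘ ofComplex) z))
      ((Polynomial.derivative p).eval (kleinJ τ) *
        (2 * Real.pi * Complex.I * (-(E₄ τ ^ 2 * E₆ τ / (1728 * etaH τ ^ 24))))) (τ : ℂ) := by
  have hp : HasDerivAt (fun t ↦ p.eval t) ((Polynomial.derivative p).eval (kleinJ τ))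
      ((kleinJ ∘ ofComplex) (τ : ℂ)) := by
    simpa using p.hasDerivAt (kleinJ τ)
  exact hp.comp (τ : ℂ) (hasDerivAt_kleinJ τ)

/-- The weight `-1` form `E₄ E₆ ∏ (J - xᵢ) / η²²`, whose inverse square is `fForm`. -/
noncomputable def seed {n : ℕ} (x : Fin n → ℝ) (τ : ℍ) : ℂ :=
  E₄ τ * E₆ τ * (rootPoly x).eval (kleinJ τ) / etaH τ ^ 22

/-- The derivative of `seed`. -/
noncomputable def seedDeriv {n : ℕ} (x : Fin n → ℝ) (τ : ℍ) : ℂ :=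
  2 * Real.pi * Complex.I *
    (-(E2 τ / 12 * seed x τ) + 1728 * etaH τ ^ 2 * (auxPoly x).eval (kleinJ τ))

/-- The identity also holds at the zeros of `seed`, where both sides take the default value `0`. -/
lemma fForm_eq {n : ℕ} (x : Fin n → ℝ) (τ : ℍ) : fForm x τ = (seed x τ ^ 2)⁻¹ := by
  rw [fForm, seed, rootPoly_eval, Finset.prod_pow, ← etaH]
  rw [div_pow, inv_div]
  congr 1 <;> ring

lemma hasDerivAt_seed {n : ℕ} (x : Fin n → ℝ) (τ : ℍ) :
    HasDerivAt (seed x ∘ ofComplex) (seedDeriv x τ) (τ : ℂ) := by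
  have h0 : etaH τ ≠ 0 := etaH_ne_zero τ
  have h := ((((hasDerivAt_E₄ τ).fun_mul (hasDerivAt_E₆ τ)).fun_mul
    (hasDerivAt_eval_kleinJ (rootPoly x) τ)).fun_div
    ((hasDerivAt_etaH τ).fun_pow 22) (by simp [h0]))
  refine h.congr_deriv ?_
  simp only [Function.comp, ofComplex_apply, seedDeriv, seed, auxPoly, Polynomial.eval_sub,
    Polynomial.eval_mul, Polynomial.eval_neg, Polynomial.eval_C, Polynomial.eval_X,
    Polynomial.eval_one]
  have h4 := E₄_cube_eq τ
  have h6 := E₆_sq_eq τ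
  generalize (rootPoly x).eval (kleinJ τ) = p
  generalize (Polynomial.derivative (rootPoly x)).eval (kleinJ τ) = p'
  generalize kleinJ τ = J at *
  generalize E₄ τ = a at *
  generalize E₆ τ = b at *
  generalize E2 τ = e
  generalize etaH τ = t at *
  field_simp
  push_cast
  linear_combination (-(2 * p * 1728 * t ^ 24 * 1728) - 6 * 1728 * p' * (1728 * t ^ 24 * J)) * h6 +
    (-(3 * p * 1728 * t ^ 24 * 1728) - 6 * 1728 * p' * b ^ 2) * h4

/-- Differentiating `R(J)` contributes `(c² - 1/144) E₄ u`, since `DJ = -E₄² E₆ / (1728 η²⁴)` and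
`R' = (1/144 - c²) P`. Differentiating `-E₂/12` contributes `E₄ u / 144`. The terms in `E₂` cancel,
leaving `D²u = c² E₄ u`. -/
lemma hasDerivAt_seedDeriv {n : ℕ} {x : Fin n → ℝ} (hx : IsSolution 8 9 12 x) (τ : ℍ) :
    HasDerivAt (seedDeriv x ∘ ofComplex)
      (-(4 * (Real.pi : ℂ) ^ 2 * ((12 * n + 11) / 12) ^ 2 * E₄ τ) * seed x τ) (τ : ℂ) := by
  have h0 : etaH τ ≠ 0 := etaH_ne_zero τ
  have h := ((((hasDerivAt_E2 τ).div_const 12).fun_mul (hasDerivAt_seed x τ)).fun_neg.fun_add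
    ((((hasDerivAt_etaH τ).fun_pow 2).const_mul 1728).fun_mul
      (hasDerivAt_eval_kleinJ (auxPoly x) τ))).const_mul
      (2 * Real.pi * Complex.I)
  refine h.congr_deriv ?_
  rw [derivative_auxPoly hx]
  simp only [Function.comp, ofComplex_apply, seedDeriv, seed, Polynomial.eval_mul,
    Polynomial.eval_C]
  generalize (rootPoly x).eval (kleinJ τ) = p
  generalize (auxPoly x).eval (kleinJ τ) = r
  generalize E₄ τ = a at *
  generalize E₆ τ = b at *
  generalize E2 τ = e
  generalize etaH τ = t at *
  have hI2 := Complex.I_sq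
  field_simp
  rw [hI2]
  push_cast
  ring

end ModularODE

/-! ### Solutions of `u'' = Q u`: unique continuation and the Wronskian. -/

namespace ModularODE

open ModularForm EisensteinSeries Function

section LinearODE

/-- A solution of `u'' = Q u` on the upper half-plane vanishing to second order at a point is
identically zero. -/
lemma eq_zero_of_ode {u u' Q : ℂ → ℂ} (hu : ∀ z ∈ upperHalfPlaneSet, HasDerivAt u (u' z) z)
    (hu' : ∀ z ∈ upperHalfPlaneSet, HasDerivAt u' (Q z * u z) z)
    (hQ : DifferentiableOn ℂ Q upperHalfPlaneSet) {a : ℂ} (ha : a ∈ upperHalfPlaneSet)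
    (h0 : u a = 0) (h1 : u' a = 0) : ∀ z ∈ upperHalfPlaneSet, u z = 0 := by
  have hU := isOpen_upperHalfPlaneSet
  have hua : AnalyticOnNhd ℂ u upperHalfPlaneSet :=
    DifferentiableOn.analyticOnNhd (fun z hz ↦ (hu z hz).differentiableAt.differentiableWithinAt) hU
  have hu'a : AnalyticOnNhd ℂ u' upperHalfPlaneSet :=
    DifferentiableOn.analyticOnNhd
      (fun z hz ↦ (hu' z hz).differentiableAt.differentiableWithinAt) hU
  have hQa := hQ.analyticOnNhd hU
  have hev : deriv u =ᶠ[𝓝 a] u' := by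
    filter_upwards [hU.mem_nhds ha] with z hz using (hu z hz).deriv
  have hev' : deriv u' =ᶠ[𝓝 a] Q * u := by
    filter_upwards [hU.mem_nhds ha] with z hz using (hu' z hz).deriv
  have e1 := (hua a ha).analyticOrderAt_deriv_add_one
  have e2 := (hu'a a ha).analyticOrderAt_deriv_add_one
  simp only [h0, h1, sub_zero] at e1 e2
  rw [analyticOrderAt_congr hev] at e1
  rw [analyticOrderAt_congr hev', analyticOrderAt_mul (hQa a ha) (hua a ha)] at e2
  -- A finite order `m` of `u` at `a` would satisfy `m = ord(Q u) + 2 ≥ m + 2`.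
  have htop : analyticOrderAt u a = ⊤ := by
    by_contra hne
    obtain ⟨m, hm⟩ := ENat.ne_top_iff_exists.mp hne
    have hle : analyticOrderAt u a + 1 + 1 ≤ analyticOrderAt u a := by
      calc analyticOrderAt u a + 1 + 1
          ≤ analyticOrderAt Q a + analyticOrderAt u a + 1 + 1 := by gcongr; exact le_add_self
        _ = analyticOrderAt u a := by rw [e2, e1]
    rw [← hm] at hle
    norm_cast at hle
    omega
  exact hua.eqOn_zero_of_preconnected_of_eventuallyEq_zero
    (convex_halfSpace_im_gt 0).isPreconnected ha (analyticOrderAt_eq_top.mp htop)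

/-- The Wronskian of two solutions of `u'' = Q u` is constant. -/
lemma wronskian_const {u u' v v' Q : ℂ → ℂ}
    (hu : ∀ z ∈ upperHalfPlaneSet, HasDerivAt u (u' z) z)
    (hu' : ∀ z ∈ upperHalfPlaneSet, HasDerivAt u' (Q z * u z) z)
    (hv : ∀ z ∈ upperHalfPlaneSet, HasDerivAt v (v' z) z)
    (hv' : ∀ z ∈ upperHalfPlaneSet, HasDerivAt v' (Q z * v z) z) :
    ∃ W : ℂ, ∀ z ∈ upperHalfPlaneSet, u z * v' z - u' z * v z = W := by
  have hd : ∀ z ∈ upperHalfPlaneSet, HasDerivAt (fun z ↦ u z * v' z - u' z * v z) 0 z :=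
    fun z hz ↦ (((hu z hz).fun_mul (hv' z hz)).fun_sub
      ((hu' z hz).fun_mul (hv z hz))).congr_deriv (by ring)
  refine ⟨u Complex.I * v' Complex.I - u' Complex.I * v Complex.I, fun z hz ↦ ?_⟩
  exact isOpen_upperHalfPlaneSet.is_const_of_deriv_eq_zero
    (convex_halfSpace_im_gt 0).isPreconnected
    (fun z hz ↦ (hd z hz).differentiableAt.differentiableWithinAt)
    (fun z hz ↦ (hd z hz).deriv) hz (by simp)

/-- Two solutions of `u'' = Q u` with different multipliers under `z ↦ z + 1` have a nonzero
Wronskian. -/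
lemma wronskian_ne_zero {u u' v v' Q : ℂ → ℂ}
    (hu : ∀ z ∈ upperHalfPlaneSet, HasDerivAt u (u' z) z)
    (hu' : ∀ z ∈ upperHalfPlaneSet, HasDerivAt u' (Q z * u z) z)
    (hv : ∀ z ∈ upperHalfPlaneSet, HasDerivAt v (v' z) z)
    (hv' : ∀ z ∈ upperHalfPlaneSet, HasDerivAt v' (Q z * v z) z)
    (hQ : DifferentiableOn ℂ Q upperHalfPlaneSet) {α β : ℂ} (hαβ : α ≠ β)
    (huT : ∀ z ∈ upperHalfPlaneSet, u (z + 1) = α * u z)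
    (hvT : ∀ z ∈ upperHalfPlaneSet, v (z + 1) = β * v z)
    {a b : ℂ} (ha : a ∈ upperHalfPlaneSet) (hua : u a ≠ 0) (hb : b ∈ upperHalfPlaneSet)
    (hvb : v b ≠ 0) {W : ℂ} (hW : ∀ z ∈ upperHalfPlaneSet, u z * v' z - u' z * v z = W) :
    W ≠ 0 := by
  rintro rfl
  -- If `W = 0`, then `v - κ u` vanishes to second order at `a`, so `v = κ u` everywhere. Distinct
  -- multipliers then force `κ = 0`, against `v b ≠ 0`.
  set κ := v a / u a with hκ
  have h := eq_zero_of_ode (u := fun z ↦ v z - κ * u z) (u' := fun z ↦ v' z - κ * u' z) (Q := Q)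
    (fun z hz ↦ (hv z hz).fun_sub ((hu z hz).const_mul κ))
    (fun z hz ↦ ((hv' z hz).fun_sub ((hu' z hz).const_mul κ)).congr_deriv (by ring)) hQ ha
    (by rw [hκ]; field_simp; ring)
    (by
      have := hW a ha
      rw [hκ]
      field_simp
      linear_combination this)
  have ha1 : a + 1 ∈ upperHalfPlaneSet := by
    simpa [upperHalfPlaneSet] using ha
  have e1 := h (a + 1) ha1
  have e0 := h a ha
  rw [huT a ha, hvT a ha] at e1
  have e2 : (β - α) * (κ * u a) = 0 := by linear_combination e1 - β * e0
  have hκ0 : κ = 0 := by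
    rcases mul_eq_zero.mp e2 with h3 | h3
    · exact absurd (sub_eq_zero.mp h3).symm hαβ
    · exact (mul_eq_zero.mp h3).resolve_right hua
  have e3 := h b hb
  rw [hκ0] at e3
  exact hvb (by linear_combination e3)

end LinearODE

/-! ### The Frobenius solution at the cusp. -/

section Frobenius

/-- The coefficients of a power series with radius of convergence at least one. -/
def SubexpGrowth (a : ℕ → ℂ) : Prop :=
  ∀ r : ℝ, 0 < r → r < 1 → ∃ B : ℝ, ∀ k, ‖a k‖ * r ^ k ≤ B

lemma SubexpGrowth.summable {a : ℕ → ℂ} (h : SubexpGrowth a) {r : ℝ} (h0 : 0 < r) (h1 : r < 1) :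
    Summable fun k ↦ ‖a k‖ * r ^ k := by
  obtain ⟨s, hs, hs1⟩ := exists_between h1
  have hs0 : 0 < s := h0.trans hs
  obtain ⟨B, hB⟩ := h s hs0 hs1
  refine Summable.of_nonneg_of_le (fun k ↦ by positivity) (fun k ↦ ?_)
    ((summable_geometric_of_lt_one (by positivity) ((div_lt_one hs0).mpr hs)).mul_left B)
  calc ‖a k‖ * r ^ k = ‖a k‖ * s ^ k * (r / s) ^ k := by rw [div_pow]; field_simp
    _ ≤ B * (r / s) ^ k := by gcongr; exact hB k

lemma SubexpGrowth.add_mul {a : ℕ → ℂ} (h : SubexpGrowth a) (c : ℂ) :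
    SubexpGrowth fun k ↦ (c + k) * a k := by
  intro r h0 h1
  obtain ⟨s, hs, hs1⟩ := exists_between h1
  have hs0 : 0 < s := h0.trans hs
  obtain ⟨B, hB⟩ := h s hs0 hs1
  have ht1 : r / s < 1 := (div_lt_one hs0).mpr hs
  have ht0 : 0 ≤ r / s := by positivity
  obtain ⟨B', hB'⟩ := (tendsto_self_mul_const_pow_of_lt_one ht0 ht1).bddAbove_range
  have hB0 : 0 ≤ B := le_trans (by positivity) (hB 0)
  refine ⟨B * (‖c‖ + B'), fun k ↦ ?_⟩
  have h2 : (k : ℝ) * (r / s) ^ k ≤ B' := hB' ⟨k, rfl⟩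
  have h3 : (r / s) ^ k ≤ 1 := pow_le_one₀ ht0 ht1.le
  have h4 : ‖c + k‖ ≤ ‖c‖ + k := (norm_add_le _ _).trans (by simp)
  calc ‖(c + k) * a k‖ * r ^ k = ‖a k‖ * s ^ k * (‖c + k‖ * (r / s) ^ k) := by
        rw [norm_mul, div_pow]; field_simp
    _ ≤ B * ((‖c‖ + k) * (r / s) ^ k) := by gcongr; exact hB k
    _ ≤ B * (‖c‖ + B') := by
        gcongr
        rw [_root_.add_mul]
        gcongr
        exact mul_le_of_le_one_right (norm_nonneg c) h3

/-- The series `∑ aₖ exp(2πi(c + k)z)`. -/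
noncomputable def qSeries (c : ℝ) (a : ℕ → ℂ) (z : ℂ) : ℂ :=
  ∑' k : ℕ, a k * Complex.exp (2 * Real.pi * Complex.I * (c + k) * z)

lemma norm_qSeries_term_le {c : ℝ} (hc : 0 ≤ c) {δ : ℝ} (hδ : 0 ≤ δ) (a : ℂ) (k : ℕ) {z : ℂ}
    (hz : δ ≤ z.im) : ‖a * Complex.exp (2 * Real.pi * Complex.I * (c + k) * z)‖ ≤
      ‖a‖ * Real.exp (-(2 * Real.pi * δ)) ^ k := by
  rw [norm_mul, Complex.norm_exp, ← Real.exp_nat_mul]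
  gcongr
  have : (2 * Real.pi * Complex.I * (c + k) * z).re = -(2 * Real.pi * ((c + k) * z.im)) := by
    simp [Complex.mul_re, Complex.mul_im]
    ring
  rw [this]
  have h2 : (k : ℝ) * δ ≤ (c + k) * z.im := by
    have : (k : ℝ) * δ ≤ k * z.im := by gcongr
    nlinarith [mul_nonneg hc (hδ.trans hz)]
  have := mul_le_mul_of_nonneg_left h2 Real.two_pi_pos.le
  linarith

lemma exp_neg_mem {δ : ℝ} (hδ : 0 < δ) : Real.exp (-(2 * Real.pi * δ)) < 1 := by
  rw [Real.exp_lt_one_iff]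
  have := Real.pi_pos
  simp only [neg_lt_zero]
  positivity

lemma SubexpGrowth.summable_norm {a : ℕ → ℂ} (h : SubexpGrowth a) {c : ℝ} (hc : 0 ≤ c) {z : ℂ}
    (hz : z ∈ upperHalfPlaneSet) :
    Summable fun k : ℕ ↦ ‖a k * Complex.exp (2 * Real.pi * Complex.I * (c + k) * z)‖ :=
  Summable.of_nonneg_of_le (fun _ ↦ norm_nonneg _)
    (fun k ↦ norm_qSeries_term_le hc (le_of_lt hz) (a k) k le_rfl)
    (h.summable (Real.exp_pos _) (exp_neg_mem hz))

lemma hasDerivAt_qSeries {a : ℕ → ℂ} (h : SubexpGrowth a) {c : ℝ} (hc : 0 ≤ c) {z : ℂ}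
    (hz : z ∈ upperHalfPlaneSet) : HasDerivAt (qSeries c a)
      (2 * Real.pi * Complex.I * qSeries c (fun k ↦ (c + k) * a k) z) z := by
  obtain ⟨δ, hδ0, hδ⟩ := exists_between (show (0 : ℝ) < z.im from hz)
  set V : Set ℂ := {w | δ < w.im} with hV
  have hVo : IsOpen V := isOpen_lt continuous_const Complex.continuous_im
  have hdiff : ∀ k : ℕ, ∀ w : ℂ, HasDerivAt
      (fun w ↦ a k * Complex.exp (2 * Real.pi * Complex.I * (c + k) * w))
      (2 * Real.pi * Complex.I * ((c + k) * a k *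
        Complex.exp (2 * Real.pi * Complex.I * (c + k) * w))) w := fun k w ↦
    ((((hasDerivAt_id w).const_mul (2 * Real.pi * Complex.I * (c + k : ℂ))).cexp).const_mul
      (a k)).congr_deriv (by simp; ring)
  have hle : ∀ (k : ℕ) (w : ℂ), w ∈ V → ‖a k * Complex.exp (2 * Real.pi * Complex.I * (c + k) * w)‖
      ≤ ‖a k‖ * Real.exp (-(2 * Real.pi * δ)) ^ k := fun k w hw ↦
    norm_qSeries_term_le hc hδ0.le (a k) k (le_of_lt hw)
  have hs := h.summable (Real.exp_pos _) (exp_neg_mem hδ0)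
  have hd := Complex.hasSum_deriv_of_summable_norm hs
    (fun k w _ ↦ (hdiff k w).differentiableAt.differentiableWithinAt) hVo hle
    (show z ∈ V from hδ)
  have hD := (Complex.differentiableOn_tsum_of_summable_norm hs
    (fun k w _ ↦ (hdiff k w).differentiableAt.differentiableWithinAt) hVo hle).differentiableAt
      (hVo.mem_nhds hδ)
  have e := hd.tsum_eq
  simp only [fun k ↦ (hdiff k z).deriv, tsum_mul_left] at e
  refine hD.hasDerivAt.congr_deriv ?_
  rw [← e]
  rfl

lemma qSeries_mul {a e : ℕ → ℂ} (ha : SubexpGrowth a) (he : SubexpGrowth e) {c : ℝ} (hc : 0 ≤ c)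
    {z : ℂ} (hz : z ∈ upperHalfPlaneSet) : qSeries 0 e z * qSeries c a z =
      qSeries c (fun k ↦ ∑ p ∈ Finset.HasAntidiagonal.antidiagonal k, e p.1 * a p.2) z := by
  rw [qSeries, qSeries, tsum_mul_tsum_eq_tsum_sum_antidiagonal_of_summable_norm
    (he.summable_norm le_rfl hz) (ha.summable_norm hc hz), qSeries]
  refine tsum_congr fun k ↦ ?_
  rw [Finset.sum_mul]
  refine Finset.sum_congr rfl fun p hp ↦ ?_
  rw [← Finset.HasAntidiagonal.mem_antidiagonal.mp hp]
  push_cast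
  rw [show (2 * Real.pi * Complex.I * (c + (p.1 + p.2)) * z : ℂ) =
    2 * Real.pi * Complex.I * (0 + p.1) * z + 2 * Real.pi * Complex.I * (c + p.2) * z by ring,
    Complex.exp_add]
  ring

/-- The coefficients of the Frobenius solution with leading exponent `c`. -/
noncomputable def frobeniusCoeff (c : ℝ) (e : ℕ → ℂ) : ℕ → ℂ
  | 0 => 1
  | (k + 1) => c ^ 2 / ((k + 1) ^ 2 + 2 * c * (k + 1)) *
      ∑ j : Fin (k + 1), e (k + 1 - j) * frobeniusCoeff c e j

lemma frobeniusCoeff_succ (c : ℝ) (e : ℕ → ℂ) (k : ℕ) : frobeniusCoeff c e (k + 1) =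
    c ^ 2 / ((k + 1) ^ 2 + 2 * c * (k + 1)) *
      ∑ j ∈ Finset.range (k + 1), e (k + 1 - j) * frobeniusCoeff c e j := by
  rw [frobeniusCoeff, Finset.sum_range fun j ↦ e (k + 1 - j) * frobeniusCoeff c e j]

/-- This is the coefficient form of `D²v = c² E₄ v`. Moving the term `c² e₀ bₖ` to the left leaves
the factor `(c + k)² - c² = k² + 2ck`, nonzero for `k ≥ 1` because `c > 0`. -/
lemma frobeniusCoeff_rec {c : ℝ} (hc : 0 < c) {e : ℕ → ℂ} (he : e 0 = 1) (k : ℕ) :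
    (c + k) * ((c + k) * frobeniusCoeff c e k) = c ^ 2 *
      ∑ p ∈ Finset.HasAntidiagonal.antidiagonal k, e p.1 * frobeniusCoeff c e p.2 := by
  rw [← Finset.Nat.sum_antidiagonal_swap]
  simp only [Prod.fst_swap, Prod.snd_swap]
  rw [Finset.Nat.sum_antidiagonal_eq_sum_range_succ (fun i j ↦ e j * frobeniusCoeff c e i) k,
    Finset.sum_range_succ, Nat.sub_self, he]
  rcases k with _ | k
  · simp
    ring
  · have h := frobeniusCoeff_succ c e k
    have hne : ((k + 1) ^ 2 + 2 * c * (k + 1) : ℂ) ≠ 0 := by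
      have : (0 : ℝ) < (k + 1) ^ 2 + 2 * c * (k + 1) := by positivity
      exact_mod_cast this.ne'
    rw [div_mul_eq_mul_div, eq_div_iff hne] at h
    push_cast
    linear_combination h

lemma subexpGrowth_frobeniusCoeff {c : ℝ} (hc : 0 < c) {e : ℕ → ℂ} (he : SubexpGrowth e) :
    SubexpGrowth (frobeniusCoeff c e) := by
  intro r h0 h1
  obtain ⟨M, hM⟩ := he r h0 h1
  have hM0 : 0 ≤ M := le_trans (by positivity) (hM 0)
  -- If `‖eⱼ‖ rʲ ≤ M` and the earlier `β j` are at most `B`, the recursion bounds `β k` by `c² M k B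
  -- / (k² + 2ck)`, which is at most `B` once `k ≥ c² M`. The finitely many earlier terms are
  -- absorbed into `B`.
  obtain ⟨K, hK⟩ := exists_nat_ge (c ^ 2 * M)
  set β : ℕ → ℝ := fun k ↦ ‖frobeniusCoeff c e k‖ * r ^ k with hβ
  have hβ0 : ∀ k, 0 ≤ β k := fun k ↦ by positivity
  set B := ∑ k ∈ Finset.range (K + 1), β k with hB
  have hB0 : 0 ≤ B := Finset.sum_nonneg fun k _ ↦ hβ0 k
  refine ⟨B, fun k ↦ ?_⟩
  change β k ≤ B
  induction k using Nat.strong_induction_on with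
  | _ k ih =>
    rcases lt_or_ge k (K + 1) with hk | hk
    · exact Finset.single_le_sum (fun i _ ↦ hβ0 i) (Finset.mem_range.mpr hk)
    · obtain ⟨m, rfl⟩ : ∃ m, k = m + 1 := ⟨k - 1, by omega⟩
      have hD : (0 : ℝ) < (m + 1) ^ 2 + 2 * c * (m + 1) := by positivity
      have hsum : ‖∑ j ∈ Finset.range (m + 1), e (m + 1 - j) * frobeniusCoeff c e j‖ * r ^ (m + 1) ≤
          (m + 1) * (M * B) := by
        calc _ ≤ (∑ j ∈ Finset.range (m + 1), ‖e (m + 1 - j) * frobeniusCoeff c e j‖) *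
                r ^ (m + 1) := by gcongr; exact norm_sum_le _ _
          _ = ∑ j ∈ Finset.range (m + 1), (‖e (m + 1 - j)‖ * r ^ (m + 1 - j)) * β j := by
              rw [Finset.sum_mul]
              refine Finset.sum_congr rfl fun j hj ↦ ?_
              have : r ^ (m + 1) = r ^ (m + 1 - j) * r ^ j := by
                rw [← pow_add]; congr 1; have := Finset.mem_range.mp hj; omega
              rw [norm_mul, this, hβ]
              ring
          _ ≤ ∑ j ∈ Finset.range (m + 1), M * B := by
              refine Finset.sum_le_sum fun j hj ↦ ?_
              exact mul_le_mul (hM _) (ih j (Finset.mem_range.mp hj)) (hβ0 j) hM0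
          _ = (m + 1) * (M * B) := by simp
      have hnorm : ‖(c ^ 2 / ((m + 1) ^ 2 + 2 * c * (m + 1)) : ℂ)‖ =
          c ^ 2 / ((m + 1) ^ 2 + 2 * c * (m + 1)) := by
        have : (c ^ 2 / ((m + 1) ^ 2 + 2 * c * (m + 1)) : ℂ) =
          ((c ^ 2 / ((m + 1) ^ 2 + 2 * c * (m + 1)) : ℝ) : ℂ) := by push_cast; rfl
        rw [this, Complex.norm_real, Real.norm_of_nonneg (by positivity)]
      simp only [hβ]
      rw [frobeniusCoeff_succ, norm_mul, hnorm, mul_assoc]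
      calc _ ≤ c ^ 2 / ((m + 1) ^ 2 + 2 * c * (m + 1)) * ((m + 1) * (M * B)) := by gcongr
        _ ≤ B := by
          rw [div_mul_eq_mul_div, div_le_iff₀ hD]
          have hKm : c ^ 2 * M ≤ m + 1 := hK.trans (by exact_mod_cast (by omega : K ≤ m + 1))
          have h5 : c ^ 2 * M * ((m + 1) * B) ≤ (m + 1) * ((m + 1) * B) := by gcongr
          have h6 : 0 ≤ B * (2 * c * (m + 1)) := by positivity
          nlinarith

end Frobenius

lemma hasSum_E₄ (τ : ℍ) :
    HasSum (fun m ↦ (qExpansion 1 E₄).coeff m * Periodic.qParam 1 τ ^ m) (E₄ τ) :=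
  hasSum_qExpansion E₄ one_pos one_mem_strictPeriods_SL τ

lemma subexpGrowth_E₄ : SubexpGrowth fun m ↦ (qExpansion 1 E₄).coeff m := by
  intro r h0 h1
  have hl : Real.log r < 0 := Real.log_neg h0 h1
  -- The point `τ = -i log r / 2π` has `q = r`, and a convergent series there has bounded terms.
  have him : 0 < (Complex.I * (-Real.log r / (2 * Real.pi) : ℝ)).im := by
    have : 0 < -Real.log r / (2 * Real.pi) := div_pos (neg_pos.mpr hl) Real.two_pi_pos
    rwa [Complex.im_mul_ofReal, Complex.I_im, one_mul]
  have h := (hasSum_E₄ ⟨_, him⟩).summable.tendsto_atTop_zero.norm.bddAbove_range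
  obtain ⟨B, hB⟩ := h
  refine ⟨B, fun k ↦ ?_⟩
  have hq : Periodic.qParam 1 (Complex.I * (-Real.log r / (2 * Real.pi) : ℝ)) = r := by
    have hpi : (Real.pi : ℂ) ≠ 0 := by exact_mod_cast Real.pi_ne_zero
    rw [Periodic.qParam]
    have : 2 * Real.pi * Complex.I * (Complex.I * (-Real.log r / (2 * Real.pi) : ℝ)) / (1 : ℝ) =
        (Real.log r : ℂ) := by
      push_cast
      field_simp
      rw [Complex.I_sq]
      ring
    rw [this, ← Complex.ofReal_exp, Real.exp_log h0]
  have := hB ⟨k, rfl⟩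
  simp only [hq] at this
  rwa [norm_mul, norm_pow, Complex.norm_real, Real.norm_of_nonneg h0.le] at this

lemma qSeries_E₄ (τ : ℍ) : qSeries 0 (fun m ↦ (qExpansion 1 E₄).coeff m) τ = E₄ τ := by
  rw [← (hasSum_E₄ τ).tsum_eq, qSeries]
  refine tsum_congr fun k ↦ ?_
  rw [Periodic.qParam, ← Complex.exp_nat_mul]
  congr 2
  push_cast
  ring

/-- The solution of `D² v = c² E₄ v` with exponent `c` at the cusp. -/
lemma exists_frobenius_solution {c : ℝ} (hc : 0 < c) : ∃ v v' : ℂ → ℂ,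
    (∀ z ∈ upperHalfPlaneSet, HasDerivAt v (v' z) z) ∧
    (∀ z ∈ upperHalfPlaneSet,
      HasDerivAt v' (-(4 * (Real.pi : ℂ) ^ 2 * c ^ 2 * E₄ (ofComplex z)) * v z) z) ∧
    (∀ z ∈ upperHalfPlaneSet, v (z + 1) = Complex.exp (2 * Real.pi * Complex.I * c) * v z) ∧
    ∃ z ∈ upperHalfPlaneSet, v z ≠ 0 := by
  set e : ℕ → ℂ := fun m ↦ (qExpansion 1 E₄).coeff m with he
  have he0 : e 0 = 1 := E_qExpansion_coeff_zero (by norm_num) (by decide)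
  set b := frobeniusCoeff c e with hb
  have hbg : SubexpGrowth b := subexpGrowth_frobeniusCoeff hc subexpGrowth_E₄
  refine ⟨qSeries c b, fun z ↦ 2 * Real.pi * Complex.I * qSeries c (fun k ↦ (c + k) * b k) z,
    fun z hz ↦ hasDerivAt_qSeries hbg hc.le hz, fun z hz ↦ ?_, fun z hz ↦ ?_, ?_⟩
  · refine ((hasDerivAt_qSeries (hbg.add_mul c) hc.le hz).const_mul
      (2 * Real.pi * Complex.I)).congr_deriv ?_
    have h1 : qSeries c (fun k ↦ (c + k) * ((c + k) * b k)) z =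
        c ^ 2 * (E₄ (ofComplex z) * qSeries c b z) := by
      have hz' : (ofComplex z : ℂ) = z := by rw [ofComplex_apply_of_im_pos hz]
      rw [← qSeries_E₄, hz', qSeries_mul hbg subexpGrowth_E₄ hc.le hz, qSeries, qSeries,
        ← tsum_mul_left]
      refine tsum_congr fun k ↦ ?_
      rw [hb, frobeniusCoeff_rec hc he0 k]
      ring
    rw [h1]
    linear_combination 4 * (Real.pi : ℂ) ^ 2 * (c ^ 2 * (E₄ (ofComplex z) * qSeries c b z)) *
      Complex.I_sq
  · rw [qSeries, qSeries, ← tsum_mul_left]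
    refine tsum_congr fun k ↦ ?_
    rw [show (2 * Real.pi * Complex.I * (c + k) * (z + 1) : ℂ) = 2 * Real.pi * Complex.I * c +
      2 * Real.pi * Complex.I * (c + k) * z + k * (2 * Real.pi * Complex.I) by ring,
      Complex.exp_add, Complex.exp_nat_mul_two_pi_mul_I, Complex.exp_add]
    ring
  -- If `v` vanished identically, `∑ bₘ qᵐ` would be a `q`-expansion of the zero form, contradicting
  -- `b₀ = 1`. The weight 4 plays no role.
  · by_contra! hcon
    have h : ∀ τ : ℍ, HasSum (fun m ↦ b m • Periodic.qParam 1 τ ^ m)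
        ((0 : ModularForm 𝒮ℒ 4) τ) := fun τ ↦ by
      have h1 := (hbg.summable_norm hc.le τ.2).of_norm.hasSum
      have h2 := h1.mul_left (Complex.exp (-(2 * Real.pi * Complex.I * c * τ)))
      have h3 : (∑' k : ℕ, b k * Complex.exp (2 * Real.pi * Complex.I * (c + k) * τ)) = 0 :=
        hcon τ τ.2
      rw [h3, mul_zero] at h2
      have h4 : (fun m ↦ b m • Periodic.qParam 1 τ ^ m) = fun i : ℕ ↦
          Complex.exp (-(2 * Real.pi * Complex.I * c * τ)) *
            (b i * Complex.exp (2 * Real.pi * Complex.I * (c + i) * τ)) := by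
        ext m
        rw [smul_eq_mul, Periodic.qParam, ← Complex.exp_nat_mul, mul_left_comm, ← Complex.exp_add]
        congr 2
        push_cast
        ring
      rw [h4]
      exact h2
    have h0 := ModularFormClass.qExpansion_coeff_unique one_pos one_mem_strictPeriods_SL h 0
    have : b 0 = 1 := by rw [hb, frobeniusCoeff]
    rw [this, FunLike.coe_zero, qExpansion_zero] at h0
    simp at h0

end ModularODE

/-! ### `J` separates `SL(2, ℤ)`-orbits, by way of Weierstrass functions. -/

namespace ModularODE

section Lattice

open PeriodPair

/-- The regular-singular equation `w f' A = B f` with `A 0 = -4`, `B 0 = 12` has no nonzero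
analytic solution at the origin. -/
lemma eventually_eq_zero_of_regular_singular {f A B : ℂ → ℂ} (hf : AnalyticAt ℂ f 0)
    (hA : ContinuousAt A 0) (hB : ContinuousAt B 0) (hA0 : A 0 = -4) (hB0 : B 0 = 12)
    (h : ∀ᶠ w in 𝓝[≠] (0 : ℂ), w * deriv f w * A w = B w * f w) : ∀ᶠ w in 𝓝 (0 : ℂ), f w = 0 := by
  by_contra hne
  obtain ⟨m, g, hg, hg0, hfg⟩ := hf.exists_eventuallyEq_pow_smul_nonzero_iff.mpr hne
  simp only [sub_zero, smul_eq_mul] at hfg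
  have hder : ∀ᶠ w in 𝓝 (0 : ℂ), w * deriv f w = w ^ m * (m * g w + w * deriv g w) := by
    filter_upwards [hfg.eventually_nhds, hg.eventually_analyticAt] with w hw hgw
    have hw' : f =ᶠ[𝓝 w] fun z ↦ z ^ m * g z := hw
    rw [hw'.deriv_eq, ((hasDerivAt_pow m w).fun_mul hgw.differentiableAt.hasDerivAt).deriv]
    rcases m with _ | m
    · simp
    · simp
      ring
  have hlim : ∀ᶠ w in 𝓝[≠] (0 : ℂ), (m * g w + w * deriv g w) * A w - B w * g w = 0 := by
    filter_upwards [h, hfg.filter_mono nhdsWithin_le_nhds, hder.filter_mono nhdsWithin_le_nhds,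
      self_mem_nhdsWithin] with w h1 h2 h3 h4
    have hw : w ^ m ≠ 0 := pow_ne_zero _ h4
    rw [h3, h2] at h1
    apply mul_left_cancel₀ hw
    linear_combination h1
  have hc : ContinuousAt (fun w ↦ (m * g w + w * deriv g w) * A w - B w * g w) 0 := by
    have h1 := hg.continuousAt
    have h2 := hg.deriv.continuousAt
    fun_prop
  have hl := tendsto_nhds_unique (hc.tendsto.mono_left nhdsWithin_le_nhds)
    (tendsto_const_nhds.congr' (hlim.mono fun w hw ↦ hw.symm))
  simp only [zero_mul, add_zero, hA0, hB0] at hl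
  -- With leading term `g(0) wᵐ`, the equation forces `-4m = 12`, impossible for `m ≥ 0`.
  have h5 : ((4 * m + 12 : ℕ) : ℂ) * g 0 = 0 := by push_cast; linear_combination -hl
  rcases mul_eq_zero.mp h5 with h6 | h6
  · norm_cast at h6
  · exact hg0 h6

lemma weierstrassP_eq_except (L : PeriodPair) (z : ℂ) :
    L.weierstrassP z = L.weierstrassPExcept 0 z + 1 / z ^ 2 := by
  have := L.weierstrassPExcept_def 0 z
  simp at this
  rw [this]
  ring

lemma derivWeierstrassP_eq_except (L : PeriodPair) (z : ℂ) :
    L.derivWeierstrassP z = L.derivWeierstrassPExcept 0 z - 2 / z ^ 3 := by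
  have := L.derivWeierstrassPExcept_def 0 z
  simp at this
  rw [this]
  ring

/-- Subtracting the two cubic equations gives `f' (℘₁' + ℘₂') = f (4(℘₁² + ℘₁℘₂ + ℘₂²) - g₂)` for `f
= ℘₁ - ℘₂`, which is analytic at `0` because the double poles cancel. Multiplying by `w⁴` puts this
in the regular-singular form above. -/
lemma weierstrassP_eventuallyEq {L₁ L₂ : PeriodPair} (h₂ : L₁.g₂ = L₂.g₂) (h₃ : L₁.g₃ = L₂.g₃) :
    L₁.weierstrassP =ᶠ[𝓝[≠] 0] L₂.weierstrassP := by
  set f : ℂ → ℂ := fun z ↦ L₁.weierstrassPExcept 0 z - L₂.weierstrassPExcept 0 z with hf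
  have hE₁ := L₁.analyticAt_weierstrassPExcept 0
  have hE₂ := L₂.analyticAt_weierstrassPExcept 0
  have hF₁ := (L₁.analyticAt_derivWeierstrassPExcept 0).continuousAt
  have hF₂ := (L₂.analyticAt_derivWeierstrassPExcept 0).continuousAt
  have hfa : AnalyticAt ℂ f 0 := hE₁.fun_sub hE₂
  set A : ℂ → ℂ := fun w ↦ w ^ 3 *
    (L₁.derivWeierstrassPExcept 0 w + L₂.derivWeierstrassPExcept 0 w) - 4 with hA
  set B : ℂ → ℂ := fun w ↦ 4 * ((w ^ 2 * L₁.weierstrassPExcept 0 w + 1) ^ 2 +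
    (w ^ 2 * L₁.weierstrassPExcept 0 w + 1) * (w ^ 2 * L₂.weierstrassPExcept 0 w + 1) +
    (w ^ 2 * L₂.weierstrassPExcept 0 w + 1) ^ 2) - L₁.g₂ * w ^ 4 with hB
  have hz := eventually_eq_zero_of_regular_singular (f := f) (A := A) (B := B) hfa
    (by fun_prop)
    (by have h1 := hE₁.continuousAt
        have h2 := hE₂.continuousAt
        fun_prop)
    (by simp [hA]) (by simp [hB]; norm_num) (by
      filter_upwards [self_mem_nhdsWithin,
        mem_nhdsWithin_of_mem_nhds (L₁.compl_lattice_sdiff_singleton_mem_nhds 0),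
        mem_nhdsWithin_of_mem_nhds (L₂.compl_lattice_sdiff_singleton_mem_nhds 0)] with w hw0 hw1 hw2
      have hw0' : w ≠ 0 := hw0
      have hm1 : w ∉ L₁.lattice := fun hm ↦ hw1 ⟨hm, hw0⟩
      have hm2 : w ∉ L₂.lattice := fun hm ↦ hw2 ⟨hm, hw0⟩
      have e1 := L₁.derivWeierstrassP_sq w hm1
      have e2 := L₂.derivWeierstrassP_sq w hm2
      have hd1 := (L₁.analyticOnNhd_weierstrassPExcept 0 w hw1).differentiableAt
      have hd2 := (L₂.analyticOnNhd_weierstrassPExcept 0 w hw2).differentiableAt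
      have hd : deriv f w = L₁.derivWeierstrassPExcept 0 w - L₂.derivWeierstrassPExcept 0 w := by
        rw [← L₁.eqOn_deriv_weierstrassPExcept_derivWeierstrassPExcept 0 hw1,
          ← L₂.eqOn_deriv_weierstrassPExcept_derivWeierstrassPExcept 0 hw2, hf, deriv_fun_sub hd1 hd2]
      rw [← h₂, ← h₃] at e2
      rw [weierstrassP_eq_except, derivWeierstrassP_eq_except] at e1 e2
      rw [hd]
      simp only [hA, hB, hf]
      field_simp at e1 e2
      apply mul_left_cancel₀ (pow_ne_zero 2 hw0')
      linear_combination e1 - e2)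
  filter_upwards [hz.filter_mono nhdsWithin_le_nhds] with w hw
  rw [weierstrassP_eq_except, weierstrassP_eq_except]
  simp only [hf] at hw
  linear_combination hw

/-- By the identity theorem the two functions agree near every point, and the poles of `℘` are
exactly its lattice points. -/
lemma lattice_le_of_weierstrassP_eventuallyEq {L₁ L₂ : PeriodPair}
    (h : L₁.weierstrassP =ᶠ[𝓝[≠] 0] L₂.weierstrassP) : L₁.lattice ≤ L₂.lattice := by
  intro l hl
  by_contra hl2
  have hm : MeromorphicOn (L₁.weierstrassP - L₂.weierstrassP) Set.univ := fun z _ ↦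
    (L₁.meromorphic_weierstrassP z).sub (L₂.meromorphic_weierstrassP z)
  have h0 : meromorphicOrderAt (L₁.weierstrassP - L₂.weierstrassP) 0 = ⊤ := by
    rw [meromorphicOrderAt_eq_top_iff]
    filter_upwards [h] with w hw
    simp [hw]
  have hl' : meromorphicOrderAt (L₁.weierstrassP - L₂.weierstrassP) l = ⊤ := by
    by_contra hne
    exact hm.meromorphicOrderAt_ne_top_of_isPreconnected isPreconnected_univ (Set.mem_univ l)
      (Set.mem_univ 0) hne h0
  rw [meromorphicOrderAt_eq_top_iff] at hl'
  have he : L₁.weierstrassP =ᶠ[𝓝[≠] l] L₂.weierstrassP := by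
    filter_upwards [hl'] with w hw
    simpa [sub_eq_zero] using hw
  have h1 := L₁.order_weierstrassP l hl
  rw [meromorphicOrderAt_congr he] at h1
  have h2 := (L₂.analyticOnNhd_weierstrassP l hl2).meromorphicOrderAt_nonneg
  rw [h1] at h2
  exact absurd h2 (by decide)

/-- A lattice in `ℂ` is determined by its invariants `g₂` and `g₃`. -/
lemma lattice_eq_of_g₂_g₃ {L₁ L₂ : PeriodPair} (h₂ : L₁.g₂ = L₂.g₂) (h₃ : L₁.g₃ = L₂.g₃) :
    L₁.lattice = L₂.lattice :=
  le_antisymm (lattice_le_of_weierstrassP_eventuallyEq (weierstrassP_eventuallyEq h₂ h₃))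
    (lattice_le_of_weierstrassP_eventuallyEq (weierstrassP_eventuallyEq h₂.symm h₃.symm))

/-- The period pair `(cτ, c)`. -/
noncomputable def periodPair (c : ℂ) (hc : c ≠ 0) (τ : ℍ) : PeriodPair where
  ω₁ := c * τ
  ω₂ := c
  indep := by
    rw [LinearIndependent.pair_iff]
    intro s t h
    have h1 : (s : ℂ) * τ + t = 0 := by
      apply mul_left_cancel₀ hc
      simp only [Complex.real_smul] at h
      linear_combination h
    have h2 : s = 0 := by
      have := congrArg Complex.im h1
      simpa [τ.im_ne_zero] using this
    subst h2
    simpa using h1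

lemma G_periodPair (c : ℂ) (hc : c ≠ 0) (τ : ℍ) {k : ℕ} (hk : 3 ≤ k) :
    (periodPair c hc τ).G k = (c ^ k)⁻¹ * (2 * riemannZeta k) * ModularForm.E hk τ := by
  have h := tsum_eisSummand_eq_riemannZeta_mul_eisensteinSeries hk τ
  have hE : ModularForm.E hk τ = (1 / 2 : ℂ) * eisensteinSeries (N := 1) 0 k τ := rfl
  rw [hE, show (c ^ k)⁻¹ * (2 * riemannZeta k) * ((1 / 2 : ℂ) * eisensteinSeries (N := 1) 0 k τ) =
    (c ^ k)⁻¹ * (riemannZeta k * eisensteinSeries (N := 1) 0 k τ) by ring, ← h, PeriodPair.G,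
    ← (periodPair c hc τ).latticeEquivProd.symm.toEquiv.tsum_eq, ← tsum_mul_left,
    ← (finTwoArrowEquiv ℤ).tsum_eq]
  refine tsum_congr fun v ↦ ?_
  have hl : (((periodPair c hc τ).latticeEquivProd.symm (v 0, v 1) : _) : ℂ) =
      v 0 * (c * τ) + v 1 * c := latticeEquiv_symm_apply _ _
  have hv : (finTwoArrowEquiv ℤ) v = (v 0, v 1) := rfl
  rw [hv, LinearEquiv.coe_toEquiv, hl, EisensteinSeries.eisSummand, zpow_neg, zpow_natCast,
    ← mul_inv, ← mul_pow]
  congr 2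
  ring

/-- Proportionality of the invariants of two elliptic curves with the same `j`-invariant. -/
lemma exists_scaling {a b a' b' t t' : ℂ} (ht : t ≠ 0) (ht' : t' ≠ 0)
    (ha : a ^ 3 * t' = a' ^ 3 * t) (hb : b ^ 2 * t' = b' ^ 2 * t) :
    ∃ μ : ℂ, μ ≠ 0 ∧ a' = μ ^ 4 * a ∧ b' = μ ^ 6 * b := by
  -- A twelfth root `ν` of `t' / t` works up to a cube root of unity `ω` for `a` and a sign for `b`.
  -- Replacing `ν` by `ν ω s` with `s⁴ = 1` corrects both: `ω⁴ = ω`, `ω⁶ = 1`, and `s⁶` realises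
  -- either sign.
  obtain ⟨ν, hν⟩ := IsAlgClosed.exists_pow_nat_eq (t' / t) (by norm_num : 0 < 12)
  have hν' : ν ^ 12 * t = t' := by rw [hν]; field_simp
  have hν0 : ν ≠ 0 := by rintro rfl; apply ht'; rw [← hν']; simp
  have ha3 : a' ^ 3 = (ν ^ 4 * a) ^ 3 := by
    apply mul_right_cancel₀ ht
    rw [← ha, ← hν']
    ring
  have hb2 : b' ^ 2 = (ν ^ 6 * b) ^ 2 := by
    apply mul_right_cancel₀ ht
    rw [← hb, ← hν']
    ring
  obtain ⟨ω, hω, haω⟩ : ∃ ω : ℂ, ω ^ 3 = 1 ∧ a' = ω * (ν ^ 4 * a) := by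
    by_cases h0 : ν ^ 4 * a = 0
    · refine ⟨1, one_pow 3, ?_⟩
      rw [h0] at ha3 ⊢
      simpa using ha3
    · refine ⟨a' / (ν ^ 4 * a), ?_, ?_⟩
      · rw [div_pow, ha3, div_self (pow_ne_zero 3 h0)]
      · rw [div_mul_cancel₀ _ h0]
  obtain ⟨s, hs4, hbs⟩ : ∃ s : ℂ, s ^ 4 = 1 ∧ b' = s ^ 6 * (ν ^ 6 * b) := by
    rcases sq_eq_sq_iff_eq_or_eq_neg.mp hb2 with h | h
    · exact ⟨1, by simp, by simpa using h⟩
    · refine ⟨Complex.I, Complex.I_pow_four, ?_⟩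
      rw [show Complex.I ^ 6 = Complex.I ^ 4 * Complex.I ^ 2 by ring, Complex.I_pow_four,
        Complex.I_sq, h]
      ring
  have hω0 : ω ≠ 0 := by rintro rfl; simp at hω
  have hs0 : s ≠ 0 := by rintro rfl; simp at hs4
  refine ⟨ν * ω * s, by simp [hν0, hω0, hs0], ?_, ?_⟩
  · rw [haω]
    linear_combination (-(ν ^ 4 * a * ω ^ 4)) * hs4 - (ν ^ 4 * a * ω) * hω
  · rw [hbs]
    linear_combination (-(ν ^ 6 * b * s ^ 6) * (ω ^ 3 + 1)) * hω

lemma int_comb_eq_zero {τ : ℍ} {m n : ℤ} (h : (m : ℂ) * τ + n = 0) : m = 0 ∧ n = 0 := by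
  have hm : m = 0 := by
    have := congrArg Complex.im h
    simpa [τ.im_ne_zero] using this
  subst hm
  exact ⟨rfl, by simpa using h⟩

/-- Homothetic lattices come from points in the same `SL(2, ℤ)`-orbit. -/
lemma exists_smul_eq_of_lattice_eq {c : ℂ} (hc : c ≠ 0) {τ τ' : ℍ}
    (h : (periodPair 1 one_ne_zero τ').lattice = (periodPair c hc τ).lattice) :
    ∃ γ : SL(2, ℤ), γ • τ = τ' := by
  obtain ⟨p, q, hpq⟩ := mem_lattice.mp (h ▸ (periodPair 1 one_ne_zero τ').ω₁_mem_lattice)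
  obtain ⟨r, s, hrs⟩ := mem_lattice.mp (h ▸ (periodPair 1 one_ne_zero τ').ω₂_mem_lattice)
  obtain ⟨p', q', hpq'⟩ := mem_lattice.mp (h.symm ▸ (periodPair c hc τ).ω₁_mem_lattice)
  obtain ⟨r', s', hrs'⟩ := mem_lattice.mp (h.symm ▸ (periodPair c hc τ).ω₂_mem_lattice)
  simp only [periodPair, one_mul, mul_one] at hpq hrs hpq' hrs'
  have e1 := int_comb_eq_zero (τ := τ') (m := p * p' + q * r' - 1) (n := p * q' + q * s') (by
    push_cast
    linear_combination hpq + p * hpq' + q * hrs')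
  have e2 := int_comb_eq_zero (τ := τ') (m := r * p' + s * r') (n := r * q' + s * s' - 1) (by
    push_cast
    linear_combination hrs + r * hpq' + s * hrs')
  -- The two integral changes of basis are mutually inverse, so the determinant is `±1`. Positivity
  -- of both imaginary parts selects `+1`.
  have hdet : (p * s - q * r) * (p' * s' - q' * r') = 1 := by
    linear_combination (r * q' + s * s') * e1.1 + e2.2 - (r * p' + s * r') * e1.2
  have hrel : (τ' : ℂ) * (r * τ + s) = p * τ + q := by
    apply mul_left_cancel₀ hc
    linear_combination (τ' : ℂ) * hrs - hpq
  have hden : (r * τ + s : ℂ) ≠ 0 := by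
    intro h0
    rw [show (r * (c * τ) + s * c : ℂ) = c * (r * τ + s) by ring, h0, mul_zero] at hrs
    exact zero_ne_one hrs
  have him : τ'.im * Complex.normSq (r * τ + s) = ((p * s - q * r : ℤ) : ℝ) * τ.im := by
    have h1 := congrArg Complex.re hrel
    have h2 := congrArg Complex.im hrel
    simp [Complex.normSq_apply] at h1 h2 ⊢
    linear_combination (r * τ.re + s) * h2 - r * τ.im * h1
  have hpos : 0 < p * s - q * r := by
    have h1 : 0 < τ'.im * Complex.normSq (r * τ + s) :=
      mul_pos τ'.im_pos (Complex.normSq_pos.mpr hden)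
    rw [him] at h1
    exact_mod_cast pos_of_mul_pos_left h1 τ.im_pos.le
  have hdet1 : p * s - q * r = 1 := by
    rcases Int.isUnit_iff.mp (IsUnit.of_mul_eq_one _ hdet) with h1 | h1
    · exact h1
    · omega
  obtain ⟨γ, hγ⟩ : ∃ γ : SL(2, ℤ), (γ : Matrix (Fin 2) (Fin 2) ℤ) = !![p, q; r, s] :=
    ⟨⟨!![p, q; r, s], by rw [Matrix.det_fin_two_of]; exact hdet1⟩, rfl⟩
  refine ⟨γ, ?_⟩
  ext
  rw [UpperHalfPlane.coe_specialLinearGroup_apply]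
  simp [hγ]
  rw [div_eq_iff hden, hrel]

end Lattice

open ModularForm in
/-- `J` separates the orbits of `SL(2, ℤ)`. -/
lemma exists_smul_eq_of_kleinJ_eq {τ τ' : ℍ} (h : kleinJ τ = kleinJ τ') :
    ∃ γ : SL(2, ℤ), γ • τ = τ' := by
  obtain ⟨μ, hμ, h4, h6⟩ := exists_scaling (a := E₄ τ) (b := E₆ τ) (a' := E₄ τ') (b' := E₆ τ')
    (t := etaH τ ^ 24) (t' := etaH τ' ^ 24) (pow_ne_zero _ (etaH_ne_zero τ))
    (pow_ne_zero _ (etaH_ne_zero τ'))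
    (by rw [E₄_cube_eq, E₄_cube_eq, h]; ring) (by rw [E₆_sq_eq, E₆_sq_eq, h]; ring)
  -- Scaling a lattice by `μ⁻¹` multiplies `G k` by `μ ^ k`, matching the factors `μ⁴` and `μ⁶` of
  -- `h4` and `h6`.
  refine exists_smul_eq_of_lattice_eq (inv_ne_zero hμ) (lattice_eq_of_g₂_g₃ ?_ ?_)
  · rw [PeriodPair.g₂, PeriodPair.g₂, G_periodPair _ _ _ (by norm_num),
      G_periodPair _ _ _ (by norm_num), h4]
    simp
    ring
  · rw [PeriodPair.g₃, PeriodPair.g₃, G_periodPair _ _ _ (by norm_num),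
      G_periodPair _ _ _ (by norm_num), h6]
    simp
    ring

end ModularODE

/-! ### Poles, residues, primitives and Schwarz derivative of `u⁻²`. -/

namespace ModularODE

section InverseSquare

variable {u u' Q : ℂ → ℂ}

/-- If `u'' = Q u`, the zeros of a nontrivial solution `u` are simple. -/
lemma deriv_ne_zero_of_ode (hu : ∀ z ∈ upperHalfPlaneSet, HasDerivAt u (u' z) z)
    (hu' : ∀ z ∈ upperHalfPlaneSet, HasDerivAt u' (Q z * u z) z)
    (hQ : DifferentiableOn ℂ Q upperHalfPlaneSet) {b : ℂ} (hb : b ∈ upperHalfPlaneSet)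
    (hub : u b ≠ 0) {a : ℂ} (ha : a ∈ upperHalfPlaneSet) (h0 : u a = 0) : u' a ≠ 0 :=
  fun h1 ↦ hub (eq_zero_of_ode hu hu' hQ ha h0 h1 b hb)

lemma analyticAt_of_hasDerivAt (hu : ∀ z ∈ upperHalfPlaneSet, HasDerivAt u (u' z) z) {a : ℂ}
    (ha : a ∈ upperHalfPlaneSet) : AnalyticAt ℂ u a :=
  DifferentiableOn.analyticAt (s := upperHalfPlaneSet)
    (fun z hz ↦ (hu z hz).differentiableAt.differentiableWithinAt)
    (isOpen_upperHalfPlaneSet.mem_nhds ha)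

lemma eventually_ne_zero_of_ode (hu : ∀ z ∈ upperHalfPlaneSet, HasDerivAt u (u' z) z)
    (hs : ∀ z ∈ upperHalfPlaneSet, u z = 0 → u' z ≠ 0) {a : ℂ} (ha : a ∈ upperHalfPlaneSet) :
    ∀ᶠ z in 𝓝[≠] a, z ∈ upperHalfPlaneSet ∧ u z ≠ 0 := by
  refine (eventually_nhdsWithin_of_eventually_nhds
    (isOpen_upperHalfPlaneSet.mem_nhds ha)).and ?_
  rcases (analyticAt_of_hasDerivAt hu ha).eventually_eq_zero_or_eventually_ne_zero with h | h
  · exfalso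
    have h0 : HasDerivAt u 0 a := (hasDerivAt_const a (0 : ℂ)).congr_of_eventuallyEq h
    exact hs a ha h.self_of_nhds ((hu a ha).unique h0)
  · exact h

lemma meromorphicAt_inv_sq (hu : ∀ z ∈ upperHalfPlaneSet, HasDerivAt u (u' z) z) {a : ℂ}
    (ha : a ∈ upperHalfPlaneSet) : MeromorphicAt (fun z ↦ (u z ^ 2)⁻¹) a :=
  ((analyticAt_of_hasDerivAt hu ha).meromorphicAt.fun_pow 2).fun_inv

lemma meromorphicOrderAt_inv_sq (hu : ∀ z ∈ upperHalfPlaneSet, HasDerivAt u (u' z) z)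
    {a : ℂ} (ha : a ∈ upperHalfPlaneSet) (h0 : u a = 0) (h1 : u' a ≠ 0)
    (hu' : AnalyticAt ℂ u' a) :
    meromorphicOrderAt (fun z ↦ (u z ^ 2)⁻¹) a = ((-2 : ℤ) : WithTop ℤ) := by
  have hua := analyticAt_of_hasDerivAt hu ha
  have e := hua.analyticOrderAt_deriv_add_one
  have hd : deriv u =ᶠ[𝓝 a] u' := by
    filter_upwards [isOpen_upperHalfPlaneSet.mem_nhds ha] with z hz using (hu z hz).deriv
  rw [analyticOrderAt_congr hd, hu'.analyticOrderAt_eq_zero.mpr h1] at e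
  simp only [h0, sub_zero, zero_add] at e
  have e2 : meromorphicOrderAt u a = ((1 : ℤ) : WithTop ℤ) := by
    rw [hua.meromorphicOrderAt_eq, ← e]
    rfl
  have e3 : meromorphicOrderAt (u ^ 2)⁻¹ a = ((-2 : ℤ) : WithTop ℤ) := by
    rw [meromorphicOrderAt_inv, meromorphicOrderAt_pow hua.meromorphicAt, e2]
    rfl
  exact e3

/-- The quotient of two solutions of `u'' = Q u` is an integral of a multiple of `u⁻²`. -/
lemma hasDerivAt_div_of_wronskian {v v' : ℂ → ℂ}
    (hu : ∀ z ∈ upperHalfPlaneSet, HasDerivAt u (u' z) z)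
    (hv : ∀ z ∈ upperHalfPlaneSet, HasDerivAt v (v' z) z) {W : ℂ} (hW0 : W ≠ 0)
    (hW : ∀ z ∈ upperHalfPlaneSet, u z * v' z - u' z * v z = W) {z : ℂ}
    (hz : z ∈ upperHalfPlaneSet) (h0 : u z ≠ 0) :
    HasDerivAt (fun z ↦ W⁻¹ * (v z / u z)) ((u z ^ 2)⁻¹) z := by
  refine (((hv z hz).fun_div (hu z hz) h0).const_mul W⁻¹).congr_deriv ?_
  have := hW z hz
  field_simp
  linear_combination this

lemma isIntegralOf_inv_sq {v v' : ℂ → ℂ}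
    (hu : ∀ z ∈ upperHalfPlaneSet, HasDerivAt u (u' z) z)
    (hu' : ∀ z ∈ upperHalfPlaneSet, HasDerivAt u' (Q z * u z) z)
    (hs : ∀ z ∈ upperHalfPlaneSet, u z = 0 → u' z ≠ 0)
    (hv : ∀ z ∈ upperHalfPlaneSet, HasDerivAt v (v' z) z) {W : ℂ} (hW0 : W ≠ 0)
    (hW : ∀ z ∈ upperHalfPlaneSet, u z * v' z - u' z * v z = W) :
    IsIntegralOf (fun z ↦ W⁻¹ * (v z / u z)) (fun z ↦ (u z ^ 2)⁻¹) := by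
  refine ⟨fun z hz ↦ ?_, fun z hz han ↦ hasDerivAt_div_of_wronskian hu hv hW0 hW hz fun h0 ↦ ?_⟩
  · exact (MeromorphicAt.const W⁻¹ z).fun_mul ((analyticAt_of_hasDerivAt hv hz).meromorphicAt.fun_div
      (analyticAt_of_hasDerivAt hu hz).meromorphicAt)
  -- The order `-2` rules out analyticity of `u⁻²` at a zero of `u`, whatever value it is assigned
  -- there.
  · have h1 := meromorphicOrderAt_inv_sq hu hz h0 (hs z hz h0) (analyticAt_of_hasDerivAt hu' hz)
    have h2 := han.meromorphicOrderAt_nonneg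
    rw [h1] at h2
    exact absurd h2 (by decide)

/-- A function with a primitive on a punctured neighbourhood has zero residue. -/
lemma hasResidueAt_zero_of_primitive {F h : ℂ → ℂ} {a : ℂ}
    (hd : ∀ᶠ z in 𝓝[≠] a, HasDerivAt h (F z) z) (hc : ∀ᶠ z in 𝓝[≠] a, ContinuousAt F z) :
    HasResidueAt F a 0 := by
  obtain ⟨ε, hε, hball⟩ := Metric.mem_nhdsWithin_iff.mp (hd.and hc)
  filter_upwards [Ioo_mem_nhdsGT hε] with r hr
  have hmem : ∀ z ∈ Metric.sphere a r, HasDerivAt h (F z) z ∧ ContinuousAt F z := fun z hz ↦ by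
    refine hball ⟨?_, ?_⟩
    · rw [Metric.mem_ball, Metric.mem_sphere.mp hz]
      exact hr.2
    · rintro rfl
      simp at hz
      exact hr.1.ne hz
  refine ⟨ContinuousOn.circleIntegrable hr.1.le fun z hz ↦ (hmem z hz).2.continuousWithinAt, ?_⟩
  rw [circleIntegral.integral_eq_zero_of_hasDerivWithinAt hr.1.le
    fun z hz ↦ (hmem z hz).1.hasDerivWithinAt, mul_zero]

lemma analyticAt_inv_sq (hu : ∀ z ∈ upperHalfPlaneSet, HasDerivAt u (u' z) z) {z : ℂ}
    (hz : z ∈ upperHalfPlaneSet) (h0 : u z ≠ 0) : AnalyticAt ℂ (fun z ↦ (u z ^ 2)⁻¹) z :=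
  ((analyticAt_of_hasDerivAt hu hz).fun_pow 2).fun_inv (pow_ne_zero 2 h0)

lemma hasDoublePole_inv_sq {v v' : ℂ → ℂ}
    (hu : ∀ z ∈ upperHalfPlaneSet, HasDerivAt u (u' z) z)
    (hu' : ∀ z ∈ upperHalfPlaneSet, HasDerivAt u' (Q z * u z) z)
    (hs : ∀ z ∈ upperHalfPlaneSet, u z = 0 → u' z ≠ 0)
    (hv : ∀ z ∈ upperHalfPlaneSet, HasDerivAt v (v' z) z) {W : ℂ} (hW0 : W ≠ 0)
    (hW : ∀ z ∈ upperHalfPlaneSet, u z * v' z - u' z * v z = W) {a : ℂ}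
    (ha : a ∈ upperHalfPlaneSet) (h0 : u a = 0) :
    HasDoublePoleZeroResidueAt (fun z ↦ (u z ^ 2)⁻¹) a := by
  have hev := eventually_ne_zero_of_ode hu hs ha
  refine ⟨meromorphicAt_inv_sq hu ha, meromorphicOrderAt_inv_sq hu ha h0 (hs a ha h0)
    (analyticAt_of_hasDerivAt hu' ha), hasResidueAt_zero_of_primitive
      (hev.mono fun z hz ↦ hasDerivAt_div_of_wronskian hu hv hW0 hW hz.1 hz.2)
      (hev.mono fun z hz ↦ (analyticAt_inv_sq hu hz.1 hz.2).continuousAt)⟩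

/-- The Schwarz derivative of an integral of `u⁻²`, where `u'' = Q u`, is `-2 Q`. -/
lemma schwarzian_of_isIntegralOf (hu : ∀ z ∈ upperHalfPlaneSet, HasDerivAt u (u' z) z)
    (hu' : ∀ z ∈ upperHalfPlaneSet, HasDerivAt u' (Q z * u z) z) {h : ℂ → ℂ}
    (hh : IsIntegralOf h (fun z ↦ (u z ^ 2)⁻¹)) {z : ℂ} (hz : z ∈ upperHalfPlaneSet)
    (h0 : u z ≠ 0) : schwarzian h z = -2 * Q z := by
  have hev : ∀ᶠ w in 𝓝 z, w ∈ upperHalfPlaneSet ∧ u w ≠ 0 :=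
    (isOpen_upperHalfPlaneSet.eventually_mem hz).and
      ((analyticAt_of_hasDerivAt hu hz).continuousAt.eventually_ne h0)
  have h1 : ∀ᶠ w in 𝓝 z, deriv h w = (u w ^ 2)⁻¹ := hev.mono fun w hw ↦
    (hh.2 w hw.1 (analyticAt_inv_sq hu hw.1 hw.2)).deriv
  have h2 : ∀ᶠ w in 𝓝 z, deriv (deriv h) w = -2 * u' w / u w ^ 3 := by
    filter_upwards [h1.eventually_nhds, hev] with w hw hw2
    have e : deriv h =ᶠ[𝓝 w] fun w ↦ (u w ^ 2)⁻¹ := hw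
    rw [e.deriv_eq, (((hu w hw2.1).fun_pow 2).fun_inv (pow_ne_zero 2 hw2.2)).deriv]
    have := hw2.2
    field_simp
    norm_num
    ring
  have h3 : (fun w ↦ deriv (deriv h) w / deriv h w) =ᶠ[𝓝 z] fun w ↦ -2 * (u' w / u w) := by
    filter_upwards [h1, h2, hev] with w e1 e2 hw
    have := hw.2
    rw [e1, e2]
    field_simp
  rw [schwarzian, h3.deriv_eq, (((hu' z hz).fun_div (hu z hz) h0).const_mul (-2)).deriv,
    show deriv (deriv h) z / deriv h z = -2 * (u' z / u z) from h3.self_of_nhds]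
  field_simp
  ring

end InverseSquare

end ModularODE

/-! ### Modular transformation laws and the zeros of `seed`. -/

namespace ModularODE

open ModularForm EisensteinSeries Function
open scoped Manifold

lemma apply_smul_of_slash_eq {k : ℤ} {F : ℍ → ℂ} {γ : SL(2, ℤ)} (h : F ∣[k] γ = F) (τ : ℍ) :
    F (γ • τ) = denom γ τ ^ k * F τ := by
  have h1 := congrFun h τ
  rw [SL_slash_apply] at h1
  rw [← h1, mul_comm, mul_assoc, ← zpow_add₀ (denom_ne_zero _ τ)]
  simp

lemma denom_T (τ : ℍ) : denom (ModularGroup.T : GL (Fin 2) ℝ) τ = 1 := by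
  rw [ModularGroup.denom_apply]
  simp [ModularGroup.T]

lemma E₄_smul (γ : SL(2, ℤ)) (τ : ℍ) : E₄ (γ • τ) = denom γ τ ^ 4 * E₄ τ := by
  exact_mod_cast apply_smul_of_slash_eq (modularForm_slash E₄ γ) τ

lemma E₆_smul (γ : SL(2, ℤ)) (τ : ℍ) : E₆ (γ • τ) = denom γ τ ^ 6 * E₆ τ := by
  exact_mod_cast apply_smul_of_slash_eq (modularForm_slash E₆ γ) τ

lemma etaH_pow_smul (γ : SL(2, ℤ)) (τ : ℍ) :
    etaH (γ • τ) ^ 24 = denom γ τ ^ 12 * etaH τ ^ 24 := by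
  have h := SlashInvariantForm.slash_action_generators_SL2Z discriminant_S_invariant discriminant_T_invariant γ
  exact_mod_cast apply_smul_of_slash_eq h τ

lemma kleinJ_smul (γ : SL(2, ℤ)) (τ : ℍ) : kleinJ (γ • τ) = kleinJ τ := by
  have h1 := E₄_cube_eq (γ • τ)
  rw [E₄_smul, etaH_pow_smul, mul_pow, E₄_cube_eq] at h1
  have hd := denom_ne_zero (γ : GL (Fin 2) ℝ) τ
  have he := etaH_ne_zero τ
  apply mul_left_cancel₀ (mul_ne_zero (pow_ne_zero 12 hd) (pow_ne_zero 24 he))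
  linear_combination (-1 / 1728 : ℂ) * h1

lemma E₄_eq_zero_iff (τ : ℍ) : E₄ τ = 0 ↔ kleinJ τ = 0 := by
  have h := E₄_cube_eq τ
  constructor
  · intro h0
    rw [h0] at h
    simpa [etaH_ne_zero] using h
  · intro h0
    rw [h0] at h
    simpa using h

lemma E₆_eq_zero_iff (τ : ℍ) : E₆ τ = 0 ↔ kleinJ τ = 1 := by
  have h := E₆_sq_eq τ
  rw [← sub_eq_zero (a := kleinJ τ)]
  constructor
  · intro h0
    rw [h0] at h
    simpa [etaH_ne_zero] using h
  · intro h0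
    rw [h0] at h
    simpa using h

lemma kleinJ_I : kleinJ UpperHalfPlane.I = 1 := by
  rw [← E₆_eq_zero_iff]
  have h := E₆_smul ModularGroup.S UpperHalfPlane.I
  have hS : ModularGroup.S • UpperHalfPlane.I = UpperHalfPlane.I := by
    ext
    rw [modular_S_smul]
    simp
  rw [hS, ModularGroup.denom_S] at h
  have h6 : (UpperHalfPlane.I : ℂ) ^ 6 = -1 := by
    rw [coe_I, show Complex.I ^ 6 = Complex.I ^ 4 * Complex.I ^ 2 by ring, Complex.I_pow_four,
      Complex.I_sq, one_mul]
  rw [h6] at h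
  linear_combination h / 2

lemma kleinJ_ρ : kleinJ UpperHalfPlane.ρ = 0 := by
  rw [← E₄_eq_zero_iff]
  have hT : E₄ (ModularGroup.T • ρ) = E₄ ρ := by
    rw [E₄_smul, denom_T, one_pow, one_mul]
  have hS := E₄_smul ModularGroup.S (ModularGroup.T • ρ)
  have hTc : ((ModularGroup.T • ρ : ℍ) : ℂ) = ρ + 1 := by
    rw [modular_T_smul]
    simp [add_comm]
  have hST : ModularGroup.S • ModularGroup.T • ρ = ρ := by
    ext
    rw [modular_S_smul, coe_mk, ← mul_one (_ : ℂ)⁻¹,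
      inv_mul_eq_iff_eq_mul₀ (neg_ne_zero.mpr (ne_zero _)), hTc]
    linear_combination ρ_sq
  rw [hST, ModularGroup.denom_S, hTc, hT] at hS
  -- `ST` fixes `ρ`, so `E₄(ρ) = (ρ + 1)⁴ E₄(ρ)`, and this factor is not `1`.
  have h4 : ((ρ : ℂ) + 1) ^ 4 = -ρ - 1 := by
    linear_combination ((ρ : ℂ) ^ 2 + 3 * ρ + 2) * ρ_sq
  rw [h4] at hS
  have h1 : (ρ : ℂ) + 2 ≠ 0 := by
    intro h
    have := congrArg Complex.im h
    simp at this
    exact ρ.im_ne_zero this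
  have : ((ρ : ℂ) + 2) * E₄ ρ = 0 := by linear_combination hS
  exact (mul_eq_zero.mp this).resolve_left h1

/-- The orbits on which `seed` vanishes. -/
lemma seed_eq_zero_iff {n : ℕ} (x : Fin n → ℝ) (w : Fin n → ℍ)
    (hw : ∀ i, kleinJ (w i) = (x i : ℂ)) (τ : ℍ) : seed x τ = 0 ↔ τ ∈ poleSet w := by
  have horb : ∀ τ' : ℍ, τ ∈ MulAction.orbit SL(2, ℤ) τ' ↔ kleinJ τ = kleinJ τ' := fun τ' ↦ by
    constructor
    · rintro ⟨γ, rfl⟩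
      exact kleinJ_smul γ τ'
    · intro h
      obtain ⟨γ, hγ⟩ := exists_smul_eq_of_kleinJ_eq h.symm
      exact ⟨γ, hγ⟩
  have hs : seed x τ = 0 ↔ (E₄ τ = 0 ∨ E₆ τ = 0) ∨ ∃ i, kleinJ τ = (x i : ℂ) := by
    have he := pow_ne_zero 22 (etaH_ne_zero τ)
    have hp : (∏ i, (kleinJ τ - (x i : ℂ)) = 0) ↔ ∃ i, kleinJ τ = (x i : ℂ) := by
      simp [Finset.prod_eq_zero_iff, sub_eq_zero]
    rw [seed, div_eq_zero_iff, or_iff_left he, mul_eq_zero, mul_eq_zero, rootPoly_eval, hp]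
  have hp : τ ∈ poleSet w ↔ (kleinJ τ = 1 ∨ kleinJ τ = 0) ∨ ∃ i, kleinJ τ = (x i : ℂ) := by
    rw [poleSet, Set.mem_union, Set.mem_union, Set.mem_iUnion, horb, horb, kleinJ_I, kleinJ_ρ]
    simp only [horb, hw]
  rw [hs, hp, E₄_eq_zero_iff, E₆_eq_zero_iff, or_comm (a := kleinJ τ = 0)]

lemma countable_poleSet {n : ℕ} (w : Fin n → ℍ) : (poleSet w).Countable :=
  have : Countable (Matrix (Fin 2) (Fin 2) ℤ) := inferInstanceAs (Countable (Fin 2 → Fin 2 → ℤ))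
  have : Countable SL(2, ℤ) := Subtype.countable
  ((Set.countable_range _).union (Set.countable_range _)).union
    (Set.countable_iUnion fun _ ↦ Set.countable_range _)

/-- The zeros lie in finitely many orbits of a countable group, and a countable set cannot fill the
half-plane. -/
lemma exists_seed_ne_zero {n : ℕ} (x : Fin n → ℝ) (w : Fin n → ℍ)
    (hw : ∀ i, kleinJ (w i) = (x i : ℂ)) : ∃ τ, seed x τ ≠ 0 := by
  obtain ⟨z, hz, hz'⟩ := (((countable_poleSet w).image ((↑) : ℍ → ℂ)).dense_compl
    ℝ).exists_mem_open isOpen_upperHalfPlaneSet ⟨Complex.I, by simp [upperHalfPlaneSet]⟩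
  refine ⟨⟨z, hz'⟩, fun h ↦ hz ⟨⟨z, hz'⟩, (seed_eq_zero_iff x w hw _).mp h, rfl⟩⟩

lemma etaH_T_smul (τ : ℍ) : etaH (ModularGroup.T • τ) =
    Complex.exp (2 * Real.pi * Complex.I / 24) * etaH τ := by
  have hTc : ((ModularGroup.T • τ : ℍ) : ℂ) = τ + 1 := by
    rw [modular_T_smul]
    simp [add_comm]
  have h1 : Periodic.qParam 1 (τ + 1 : ℂ) = Periodic.qParam 1 τ := by
    rw [Periodic.qParam, Periodic.qParam, ← Complex.exp_periodic (_ * (τ : ℂ) / _)]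
    congr 1
    push_cast
    ring
  rw [etaH, etaH, eta, eta, hTc]
  simp only [eta_q, h1]
  rw [← mul_assoc]
  congr 1
  rw [Periodic.qParam, Periodic.qParam, ← Complex.exp_add]
  congr 1
  push_cast
  ring

lemma seed_T_smul {n : ℕ} (x : Fin n → ℝ) (τ : ℍ) : seed x (ModularGroup.T • τ) =
    Complex.exp (-(2 * Real.pi * Complex.I * (11 / 12))) * seed x τ := by
  have h0 := etaH_ne_zero τ
  rw [seed, seed, kleinJ_smul, E₄_smul, E₆_smul, denom_T, etaH_T_smul, mul_pow, ← Complex.exp_nat_mul,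
    Complex.exp_neg,
    show ((22 : ℕ) : ℂ) * (2 * Real.pi * Complex.I / 24) = 2 * Real.pi * Complex.I * (11 / 12) by
      push_cast; ring]
  have := Complex.exp_ne_zero (2 * Real.pi * Complex.I * (11 / 12))
  field_simp

/-- `η⁴⁴` is a modular form of weight `22` with a character. -/
lemma exists_character : ∃ χ : SL(2, ℤ) →* ℂˣ, ∀ (γ : SL(2, ℤ)) (τ : ℍ),
    etaH (γ • τ) ^ 44 = χ γ * denom γ τ ^ 22 * etaH τ ^ 44 := by
  have key : ∀ γ : SL(2, ℤ), ∃ c : ℂˣ, ∀ τ : ℍ,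
      etaH (γ • τ) ^ 44 = c * denom γ τ ^ 22 * etaH τ ^ 44 := by
    intro γ
    set g : ℍ → ℂ := fun τ ↦ etaH (γ • τ) ^ 44 / (denom γ τ ^ 22 * etaH τ ^ 44) with hg
    have hd : ∀ τ : ℍ, denom (γ : GL (Fin 2) ℝ) τ ≠ 0 := fun τ ↦ denom_ne_zero _ τ
    -- Since `44 · 6 = 24 · 11`, the sixth power is governed by the modularity of `Δ = η²⁴`. A
    -- continuous function from the connected half-plane to the sixth roots of unity is constant.
    have hg6 : ∀ τ, g τ ^ 6 = 1 := fun τ ↦ by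
      have h := etaH_pow_smul γ τ
      have h1 := hd τ
      have h2 := etaH_ne_zero τ
      rw [hg]
      simp only
      rw [div_pow, ← pow_mul, show 44 * 6 = 24 * 11 by norm_num, pow_mul, h]
      field_simp
    have he : Continuous etaH := by
      have h : ∀ τ : ℍ, ContinuousAt etaH τ := fun τ ↦ by
        have h1 := ((hasDerivAt_etaH τ).continuousAt).comp continuous_coe.continuousAt
        simpa [Function.comp_def] using h1
      exact continuous_iff_continuousAt.mpr h
    have hc : Continuous g := by
      refine Continuous.div₀ ?_ ?_ fun τ ↦
        mul_ne_zero (pow_ne_zero _ (hd τ)) (pow_ne_zero _ (etaH_ne_zero τ))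
      · exact (he.comp (continuous_const_smul (γ : GL (Fin 2) ℝ))).pow _
      · simp only [ModularGroup.denom_apply]
        fun_prop
    have hfin : {z : ℂ | z ^ 6 = 1}.Finite := by
      have h : (Polynomial.X ^ 6 - 1 : Polynomial ℂ) ≠ 0 :=
        Polynomial.X_pow_sub_C_ne_zero (by norm_num) 1
      refine (Polynomial.X ^ 6 - 1 : Polynomial ℂ).roots.toFinset.finite_toSet.subset fun z hz ↦ ?_
      simpa [h, sub_eq_zero] using hz
    obtain ⟨c, hc1, hc2⟩ := (isPreconnected_univ (α := ℍ)).eqOn_const_of_mapsTo hfin.isDiscrete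
      hc.continuousOn (fun τ _ ↦ hg6 τ) ⟨1, by simp⟩
    have hc0 : c ≠ 0 := by rintro rfl; simp at hc1
    refine ⟨Units.mk0 c hc0, fun τ ↦ ?_⟩
    have := hc2 (Set.mem_univ τ)
    simp only [hg, Function.const_apply] at this
    have h1 := hd τ
    have h2 := etaH_ne_zero τ
    rw [div_eq_iff (by simp [h1, h2])] at this
    rw [this, Units.val_mk0]
    ring
  choose χ hχ using key
  refine ⟨MonoidHom.mk' χ fun γ δ ↦ ?_, hχ⟩
  ext
  -- The multipliers are constants, so multiplicativity can be checked at the single point `i` using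
  -- the cocycle relation for `denom`.
  have h1 := hχ (γ * δ) I
  have h2 := hχ γ (δ • I)
  rw [hχ δ I, ← mul_smul] at h2
  have hd : denom ((γ * δ : SL(2, ℤ)) : GL (Fin 2) ℝ) I = denom γ (δ • I : ℍ) * denom δ I := by
    have h := denom_cocycle_σ (γ : GL (Fin 2) ℝ) (δ : GL (Fin 2) ℝ) I
    rw [← map_mul, ← map_mul] at h
    simpa [σ] using h
  rw [h1, hd] at h2
  have n1 := denom_ne_zero (γ : GL (Fin 2) ℝ) (δ • I : ℍ)
  have n2 := denom_ne_zero (δ : GL (Fin 2) ℝ) I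
  have n3 := etaH_ne_zero I
  apply mul_right_cancel₀ (mul_ne_zero (mul_ne_zero (pow_ne_zero 22 n1) (pow_ne_zero 22 n2))
    (pow_ne_zero 44 n3))
  rw [Units.val_mul]
  linear_combination h2

end ModularODE

/-! ### Behaviour of the form under `SL(2, ℤ)` and at the cusp. -/

namespace ModularODE

open ModularForm EisensteinSeries Function

lemma kleinJ_eq (τ : ℍ) : kleinJ τ = E₄ τ ^ 3 / (1728 * etaH τ ^ 24) := by
  have h := etaH_ne_zero τ
  rw [eq_div_iff (by simp [h]), E₄_cube_eq]
  ring

lemma fForm_eq_second {n : ℕ} (x : Fin n → ℝ) (τ : ℍ) : fForm x τ =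
    eta τ ^ 20 / (1728 * (E₄ τ ^ 2 * (kleinJ τ - 1) * ∏ i, (kleinJ τ - (x i : ℂ)) ^ 2)) := by
  have h : eta (τ : ℂ) ≠ 0 := etaH_ne_zero τ
  have h6 := E₆_sq_eq τ
  rw [etaH] at h6
  rw [fForm, Finset.prod_pow, h6]
  field_simp

lemma fForm_smul {n : ℕ} (x : Fin n → ℝ) {χ : SL(2, ℤ) →* ℂˣ}
    (hχ : ∀ (γ : SL(2, ℤ)) (τ : ℍ), etaH (γ • τ) ^ 44 = χ γ * denom γ τ ^ 22 * etaH τ ^ 44)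
    (γ : SL(2, ℤ)) (τ : ℍ) : fForm x (γ • τ) = χ γ *
      (((γ 1 0 : ℤ) : ℂ) * (τ : ℂ) + ((γ 1 1 : ℤ) : ℂ)) ^ (2 : ℤ) * fForm x τ := by
  have hd := denom_ne_zero (γ : GL (Fin 2) ℝ) τ
  have h := hχ γ τ
  simp only [etaH] at h
  rw [← ModularGroup.denom_apply, fForm, fForm, h, E₄_smul, E₆_smul]
  simp only [kleinJ_smul]
  rw [zpow_ofNat]
  generalize ∏ i, (kleinJ τ - (x i : ℂ)) ^ 2 = p
  generalize (χ γ : ℂ) = c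
  generalize E₄ τ = a
  generalize E₆ τ = b
  generalize eta (τ : ℂ) = e
  generalize denom (γ : GL (Fin 2) ℝ) τ = d at hd
  rw [mul_div_assoc', ← mul_div_mul_left (c * d ^ 2 * e ^ 44) _ (pow_ne_zero 20 hd)]
  congr 1 <;> ring

lemma fForm_meromorphic_at_cusp {n : ℕ} (x : Fin n → ℝ) :
    ∃ N : ℕ, 0 < N ∧ ∃ F : ℂ → ℂ, MeromorphicAt F 0 ∧
      ∀ τ : ℍ, fForm x τ = F (Complex.exp (2 * Real.pi * Complex.I * (τ : ℂ) / N)) := by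
  set U : ℂ → ℂ := fun q ↦ ∏' n : ℕ, (1 - q ^ (n + 1)) with hU
  have hpow : AnalyticAt ℂ (fun s : ℂ ↦ s ^ 6) 0 := by fun_prop
  have hcomp : ∀ {G : ℂ → ℂ}, DifferentiableOn ℂ G (Metric.ball 0 1) →
      MeromorphicAt (fun s : ℂ ↦ G (s ^ 6)) 0 := fun hG ↦
    (AnalyticAt.comp_of_eq (hG.analyticAt (Metric.ball_mem_nhds 0 one_pos)) hpow
      (by simp)).meromorphicAt
  have h4 := hcomp (modularForm_eq_qParam E₄).1
  have h6 := hcomp (modularForm_eq_qParam E₆).1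
  have hu := hcomp differentiableOn_tprod_one_sub_pow
  -- The only fractional power comes from `η⁴⁴`, whose leading factor `q^(44/24) = q^(11/6)` is
  -- `s¹¹` with `s = q^(1/6)`.
  refine ⟨6, by norm_num, fun s ↦ s ^ 11 * U (s ^ 6) ^ 44 / (cuspFunction 1 E₄ (s ^ 6) ^ 2 *
    cuspFunction 1 E₆ (s ^ 6) ^ 2 * ∏ i, (cuspFunction 1 E₄ (s ^ 6) ^ 3 /
      (1728 * (s ^ 6 * U (s ^ 6) ^ 24)) - (x i : ℂ)) ^ 2), ?_, fun τ ↦ ?_⟩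
  · have hs : ∀ k : ℕ, MeromorphicAt (fun s : ℂ ↦ s ^ k) 0 := fun k ↦
      (MeromorphicAt.id 0).fun_pow k
    refine ((hs 11).fun_mul (hu.fun_pow 44)).fun_div
      (((h4.fun_pow 2).fun_mul (h6.fun_pow 2)).fun_mul
        (MeromorphicAt.fun_prod fun i _ ↦ MeromorphicAt.fun_pow ?_ 2))
    exact ((h4.fun_pow 3).fun_div ((MeromorphicAt.const 1728 0).fun_mul
      ((hs 6).fun_mul (hu.fun_pow 24)))).fun_sub (MeromorphicAt.const _ _)
  · have he : eta (τ : ℂ) = Periodic.qParam 24 τ * U (Periodic.qParam 1 τ) := rfl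
    have hq6 : Complex.exp (2 * Real.pi * Complex.I * (τ : ℂ) / (6 : ℕ)) ^ 6 =
        Periodic.qParam 1 τ := by
      rw [← Complex.exp_nat_mul, Periodic.qParam]
      congr 1
      push_cast
      ring
    have hq11 : Periodic.qParam 24 (τ : ℂ) ^ 44 =
        Complex.exp (2 * Real.pi * Complex.I * (τ : ℂ) / (6 : ℕ)) ^ 11 := by
      rw [← Complex.exp_nat_mul, Periodic.qParam, ← Complex.exp_nat_mul]
      congr 1
      push_cast
      ring
    have hq24 : Periodic.qParam 24 (τ : ℂ) ^ 24 = Periodic.qParam 1 τ := by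
      rw [Periodic.qParam, ← Complex.exp_nat_mul, Periodic.qParam]
      congr 1
      push_cast
      ring
    simp only [hq6, ← (modularForm_eq_qParam E₄).2, ← (modularForm_eq_qParam E₆).2]
    rw [fForm, he, mul_pow, hq11]
    simp only [kleinJ_eq, etaH, he, mul_pow, hq24]

/-- These are the multipliers of `u` and `v` under `τ ↦ τ + 1`. Equality would give `-11 = 12(n + m)
+ 11`, so `12` would divide `22`. -/
lemma exp_ne_exp_cusp (n : ℕ) : Complex.exp (-(2 * Real.pi * Complex.I * (11 / 12))) ≠
    Complex.exp (2 * Real.pi * Complex.I * (((12 * n + 11) / 12 : ℝ) : ℂ)) := by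
  rw [Ne, Complex.exp_eq_exp_iff_exists_int]
  rintro ⟨m, hm⟩
  have h := Complex.two_pi_I_ne_zero
  have h1 : (-(11 / 12) : ℂ) = ((12 * n + 11) / 12 : ℝ) + m := by
    apply mul_left_cancel₀ h
    linear_combination hm
  push_cast at h1
  have h2 : ((-11 : ℤ) : ℂ) = ((6 * (n + m) * 2 + 11 : ℤ) : ℂ) := by
    push_cast
    linear_combination 12 * h1
  have h3 : (-11 : ℤ) = 6 * (n + m) * 2 + 11 := by exact_mod_cast h2
  omega

end ModularODE

/-! ### Assembly of the theorem. -/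

open ModularODE

theorem theorem3p3 (n : ℕ) (x : Fin n → ℝ) (hx : ∀ i, x i ∈ Set.Ioo (0 : ℝ) 1)
    (hsol : ModularODE.IsSolution 8 9 12 x)
    (w : Fin n → UpperHalfPlane) (hw : ∀ i, ModularODE.kleinJ (w i) = (x i : ℂ)) :
    -- the second expression of the form
    (∀ τ : UpperHalfPlane, ModularODE.fForm x τ =
      ModularForm.eta τ ^ 20 / (1728 * (ModularForm.E₄ τ ^ 2 * (ModularODE.kleinJ τ - 1) *
        ∏ i, (ModularODE.kleinJ τ - (x i : ℂ)) ^ 2))) ∧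
    -- weight 2 modular form with a character
    (∃ χ : SL(2, ℤ) →* ℂˣ, ModularODE.IsMeromorphicModularForm 2 χ (ModularODE.fForm x)) ∧
    -- double poles with zero residue at `i`, `ρ`, the `wᵢ` and their translates
    (∀ τ ∈ ModularODE.poleSet w,
      ModularODE.HasDoublePoleZeroResidueAt (ModularODE.fForm x ∘ UpperHalfPlane.ofComplex) τ) ∧
    -- holomorphic and nonvanishing everywhere else
    (∀ τ : UpperHalfPlane, τ ∉ ModularODE.poleSet w →
      AnalyticAt ℂ (ModularODE.fForm x ∘ UpperHalfPlane.ofComplex) τ ∧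
        ModularODE.fForm x τ ≠ 0) ∧
    -- it has an integral on the upper half-plane
    (∃ h : ℂ → ℂ,
      ModularODE.IsIntegralOf h (ModularODE.fForm x ∘ UpperHalfPlane.ofComplex)) ∧
    -- the Schwarz derivative of its integral (holomorphic at the poles as well)
    (∀ h : ℂ → ℂ,
      ModularODE.IsIntegralOf h (ModularODE.fForm x ∘ UpperHalfPlane.ofComplex) →
      (∀ τ : UpperHalfPlane, τ ∉ ModularODE.poleSet w →
        ModularODE.schwarzian h τ =
          2 * (Real.pi : ℂ) ^ 2 * ((12 * (n : ℂ) + 11) / 6) ^ 2 * ModularForm.E₄ τ) ∧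
      (∀ τ : UpperHalfPlane,
        Tendsto (ModularODE.schwarzian h) (𝓝[≠] (τ : ℂ))
          (𝓝 (2 * (Real.pi : ℂ) ^ 2 * ((12 * (n : ℂ) + 11) / 6) ^ 2 *
            ModularForm.E₄ τ)))) := by
  set u : ℂ → ℂ := seed x ∘ ofComplex with hu_def
  set u' : ℂ → ℂ := seedDeriv x ∘ ofComplex with hu'_def
  set Q : ℂ → ℂ := fun z ↦
    -(4 * (Real.pi : ℂ) ^ 2 * ((12 * n + 11) / 12) ^ 2 * ModularForm.E₄ (ofComplex z)) with hQ_def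
  have hof : ∀ τ : ℍ, u τ = seed x τ := fun τ ↦ by simp [hu_def]
  have hu : ∀ z ∈ upperHalfPlaneSet, HasDerivAt u (u' z) z := fun z hz ↦ by
    have := hasDerivAt_seed x ⟨z, hz⟩
    rwa [hu'_def, Function.comp_apply, ofComplex_apply_of_im_pos hz]
  have hu' : ∀ z ∈ upperHalfPlaneSet, HasDerivAt u' (Q z * u z) z := fun z hz ↦ by
    have := hasDerivAt_seedDeriv hsol ⟨z, hz⟩
    simpa only [hQ_def, hu_def, Function.comp_apply, ofComplex_apply_of_im_pos hz] using this
  have hQ : DifferentiableOn ℂ Q upperHalfPlaneSet := fun z hz ↦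
    ((hasDerivAt_E₄ ⟨z, hz⟩).differentiableAt.const_mul
      _).neg.differentiableWithinAt
  have hf : fForm x ∘ ofComplex = fun z ↦ (u z ^ 2)⁻¹ := funext fun z ↦ fForm_eq x _
  have hzero := seed_eq_zero_iff x w hw
  obtain ⟨τ₀, hτ₀⟩ := exists_seed_ne_zero x w hw
  have hs : ∀ z ∈ upperHalfPlaneSet, u z = 0 → u' z ≠ 0 := fun z hz ↦
    deriv_ne_zero_of_ode hu hu' hQ τ₀.2 (hof τ₀ ▸ hτ₀) hz
  have huT : ∀ z ∈ upperHalfPlaneSet,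
      u (z + 1) = Complex.exp (-(2 * Real.pi * Complex.I * (11 / 12))) * u z := fun z hz ↦ by
    have h := seed_T_smul x ⟨z, hz⟩
    have hTc : ((ModularGroup.T • (⟨z, hz⟩ : ℍ) : ℍ) : ℂ) = z + 1 := by
      rw [modular_T_smul]
      simp [add_comm]
    rw [← hof, ← hof, hTc] at h
    exact h
  obtain ⟨v, v', hv, hv', hvT, b, hb, hvb⟩ :=
    exists_frobenius_solution (c := (12 * n + 11) / 12) (by positivity)
  replace hv' : ∀ z ∈ upperHalfPlaneSet, HasDerivAt v' (Q z * v z) z := fun z hz ↦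
    (hv' z hz).congr_deriv (by simp [hQ_def])
  obtain ⟨W, hW⟩ := wronskian_const hu hu' hv hv'
  have hW0 : W ≠ 0 := wronskian_ne_zero hu hu' hv hv' hQ (exp_ne_exp_cusp n) huT hvT τ₀.2
    (hof τ₀ ▸ hτ₀) hb hvb hW
  have hQ2 : ∀ z, -2 * Q z = 2 * (Real.pi : ℂ) ^ 2 * ((12 * (n : ℂ) + 11) / 6) ^ 2 *
      ModularForm.E₄ (ofComplex z) := fun z ↦ by
    simp only [hQ_def]
    ring
  refine ⟨fForm_eq_second x, ?_, fun τ hτ ↦ ?_, fun τ hτ ↦ ?_, ?_, fun h hh ↦ ⟨fun τ hτ ↦ ?_,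
    fun τ ↦ ?_⟩⟩
  · obtain ⟨χ, hχ⟩ := exists_character
    obtain ⟨N, hN, F, hF, hFf⟩ := fForm_meromorphic_at_cusp x
    exact ⟨χ, fun τ ↦ hf ▸ meromorphicAt_inv_sq hu τ.2, fForm_smul x hχ,
      N, hN, F, hF, Eventually.of_forall hFf⟩
  · rw [hf]
    exact hasDoublePole_inv_sq hu hu' hs hv hW0 hW τ.2 (hof τ ▸ (hzero τ).mpr hτ)
  · have h0 : seed x τ ≠ 0 := fun h ↦ hτ ((hzero τ).mp h)
    rw [hf, fForm_eq]
    exact ⟨analyticAt_inv_sq hu τ.2 (hof τ ▸ h0), inv_ne_zero (pow_ne_zero 2 h0)⟩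
  · rw [hf]
    exact ⟨_, isIntegralOf_inv_sq hu hu' hs hv hW0 hW⟩
  · have h0 : seed x τ ≠ 0 := fun h ↦ hτ ((hzero τ).mp h)
    rw [schwarzian_of_isIntegralOf hu hu' (hf ▸ hh) τ.2 (hof τ ▸ h0), hQ2, ofComplex_apply]
  -- At a pole the limit comes from the punctured neighbourhood, where `u ≠ 0` and the Schwarz
  -- derivative equals the continuous function `-2 Q`.
  · have hc : ContinuousAt (fun z ↦ -2 * Q z) τ :=
      continuousAt_const.mul
        (hQ.differentiableAt (isOpen_upperHalfPlaneSet.mem_nhds τ.2)).continuousAt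
    have ht := hc.tendsto.mono_left (nhdsWithin_le_nhds (s := {(τ : ℂ)}ᶜ))
    rw [hQ2, ofComplex_apply] at ht
    refine ht.congr' ?_
    filter_upwards [eventually_ne_zero_of_ode hu hs τ.2] with z hz
    exact (schwarzian_of_isIntegralOf hu hu' (hf ▸ hh) hz.1 hz.2).symm
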